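/- Let $Q_0=[0,1)$ with Lebesgue measure, and let $\mathcal D$ be the set of dyadic intervals $[k2^{-n},(k+1)2^{-n})\subseteq Q_0$ ($n\ge 0$, $0\le k<2^n$); for $K\in\mathcal D$ put $\mathcal D(K)=\{Q\in\mathcal D: Q\subseteq K\}$, and let $\langle\cdot\rangle_Q$ be the average over $Q$. A ($d\times d$) matrix weight is a function $W$ on $Q_0$ with values in the complex $d\times d$ matrices, almost everywhere positive semidefinite and invertible, such that $W$ and $W^{-1}$ are integrable on $Q_0$. Put $$[W]_{C_2}=\operatorname*{ess\,sup}_{x\in Q_0}\|W(x)\|_{op}\|W(x)^{-1}\|_{op}\in[0,\infty],\qquad [W]_{A_2}=\sup_{Q\in\mathcal D}\big\|\langle W\rangle_Q^{1/2}\langle W^{-1}\rangle_Q^{1/2}\big\|_{op}^2 .$$ For a weight $W$, $M\ge 0$ and $N\in[0,\infty]$, say that the bilinear embedding $\mathrm{BE}(W,M,N)$ holds if for every family $(A_Q)_{Q\in\mathcal D}$ of positive semidefinite $d\times d$ matrices with $\frac1{|K|}\sum_{Q\in\mathcal D(K)}A_Q\le M\,\mathbf 1$ for all $K\in\mathcal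 D$, and all $f,g\in L^2(Q_0;\mathbb C^d)$, $$\sum_{Q\in\mathcal D}\big\|A_Q^{1/2}\langle W\rangle_Q^{-1}\langle W^{1/2}f\rangle_Q\big\|_{\mathbb C^d}\,\big\|A_Q^{1/2}\langle W^{-1}\rangle_Q^{-1}\langle W^{-1/2}g\rangle_Q\big\|_{\mathbb C^d}\le N\,\|f\|_{L^2}\|g\|_{L^2}$$ (with $0\cdot\infty=0$). Then: (1) For every $d$ there is a finite constant $C$, depending only on $d$, such that $\mathrm{BE}(W,M,C\,M\,[W]_{C_2}^{1/2})$ holds for every $d\times d$ matrix weight $W$ and every $M\ge0$. (2) (The condition is necessary.) For every matrix weight $W$ and every finite $C\ge 0$, if $\mathrm{BE}(W,1,C)$ holds, then $[W]_{C_2}^{1/2}\le C$; in particular $[W]_{C_2}<\infty$. (3) (The power is optimal.) If $d\ge2$ and $p<1/2$, there is no finite constant $C$ such that $\mathrm{BE}(W,1,C[W]_{C_2}^{p})$ holds for all $d\times d$ matrix weights $W$ with $[W]_{C_2}<\infty$. (4) (The matrix $A_2$ condition is not sufficient.) Let $d\ge2$. There is no finite constant $C$ such that $\mathrm{BE}(W,1,C)$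 holds for all $d\times d$ matrix weights $W$ with $[W]_{A_2}=1$. Moreover, there is a $d\times d$ matrix weight $W$ with $[W]_{A_2}<\infty$ such that $\mathrm{BE}(W,1,C)$ fails for every finite $C$. -/

import Mathlib

open MeasureTheory
open scoped ENNReal NNReal ComplexOrder MatrixOrder Matrix.Norms.L2Operator

noncomputable section

namespace MatrixBET

/-- Lebesgue measure on the root interval `[0, 1)` (which differs from `[0, 1]` by a null set). -/
def rootMeasure : Measure ℝ := volume.restrict (Set.Ico 0 1)

/-- A dyadic subinterval of the root interval: the pair `⟨n, k⟩` with `k < 2 ^ n` stands for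
`[k / 2 ^ n, (k + 1) / 2 ^ n)`. -/
structure DyadicInterval where
  level : ℕ
  index : Fin (2 ^ level)

namespace DyadicInterval

/-- The set of points of a dyadic interval. -/
def toSet (Q : DyadicInterval) : Set ℝ :=
  Set.Ico ((Q.index : ℝ) / 2 ^ Q.level) (((Q.index : ℝ) + 1) / 2 ^ Q.level)

/-- The length of a dyadic interval. -/
def length (Q : DyadicInterval) : ℝ := 1 / 2 ^ Q.level

theorem volume_toSet (Q : DyadicInterval) : volume Q.toSet = ENNReal.ofReal Q.length := by
  rw [toSet, Real.volume_Ico, length]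
  congr 1
  ring

/-- The dyadic intervals contained in `K`. -/
def descendants (K : DyadicInterval) : Set DyadicInterval := {Q | Q.toSet ⊆ K.toSet}

end DyadicInterval

variable {d : ℕ}

/-- The action of a matrix on `ℂ ^ d` with its Euclidean norm. Norms of matrices in this file are
the operator norms for this action. -/
def act (M : Matrix (Fin d) (Fin d) ℂ) (v : EuclideanSpace ℂ (Fin d)) :
    EuclideanSpace ℂ (Fin d) :=
  Matrix.toEuclideanCLM (n := Fin d) (𝕜 := ℂ) M v

/-- A matrix weight: almost everywhere positive semidefinite and invertible (that is, positive
definite), integrable together with its inverse. -/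
structure IsMatrixWeight (W : ℝ → Matrix (Fin d) (Fin d) ℂ) : Prop where
  posDef : ∀ᵐ x ∂rootMeasure, (W x).PosDef
  integrable : Integrable W rootMeasure
  integrable_inv : Integrable (fun x => (W x)⁻¹) rootMeasure

/-- The average of a vector or matrix function over a dyadic interval. -/
def avg {E : Type*} [NormedAddCommGroup E] [NormedSpace ℝ E] (Q : DyadicInterval) (F : ℝ → E) :
    E :=
  ⨍ x in Q.toSet, F x

/-- The conditioning number `[W]_{C_2}`, the (essential) supremum of `‖W x‖ * ‖(W x)⁻¹‖`. -/
def condC2 (W : ℝ → Matrix (Fin d) (Fin d) ℂ) : ℝ≥0∞ :=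
  essSup (fun x => ‖W x‖ₑ * ‖(W x)⁻¹‖ₑ) rootMeasure

/-- The matrix `A_2` characteristic. -/
def charA2 (W : ℝ → Matrix (Fin d) (Fin d) ℂ) : ℝ≥0∞ :=
  ⨆ Q : DyadicInterval, ‖CFC.sqrt (avg Q W) * CFC.sqrt (avg Q fun x => (W x)⁻¹)‖ₑ ^ 2

/-- `A` is a sequence of positive semidefinite matrices with
`|K|⁻¹ ∑_{Q ∈ D(K)} A_Q ≤ M • 1` in the sense of operators, for all dyadic `K`. -/
structure IsCarleson (A : DyadicInterval → Matrix (Fin d) (Fin d) ℂ) (M : ℝ≥0) : Prop where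
  posSemidef : ∀ Q, (A Q).PosSemidef
  summable : ∀ K : DyadicInterval, Summable fun Q : K.descendants => A Q
  sum_le : ∀ K : DyadicInterval,
    K.length⁻¹ • ∑' Q : K.descendants, A Q ≤ (M : ℝ) • (1 : Matrix (Fin d) (Fin d) ℂ)

/-- The norm-product bilinear sum. -/
def bilinearSum (W : ℝ → Matrix (Fin d) (Fin d) ℂ)
    (A : DyadicInterval → Matrix (Fin d) (Fin d) ℂ) (f g : ℝ → EuclideanSpace ℂ (Fin d)) :
    ℝ≥0∞ :=
  ∑' Q : DyadicInterval,
    ‖act (CFC.sqrt (A Q)) (act (avg Q W)⁻¹ (avg Q fun x => act (CFC.sqrt (W x)) (f x)))‖ₑ *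
    ‖act (CFC.sqrt (A Q)) (act (avg Q fun x => (W x)⁻¹)⁻¹
      (avg Q fun x => act (CFC.sqrt (W x)⁻¹) (g x)))‖ₑ

/-- The bilinear embedding for the weight `W` with constant `C`, for all Carleson sequences of
intensity at most `M`. -/
def BilinearEmbedding (W : ℝ → Matrix (Fin d) (Fin d) ℂ) (M : ℝ≥0) (C : ℝ≥0∞) : Prop :=
  ∀ A : DyadicInterval → Matrix (Fin d) (Fin d) ℂ, IsCarleson A M →
    ∀ f g : ℝ → EuclideanSpace ℂ (Fin d), MemLp f 2 rootMeasure → MemLp g 2 rootMeasure →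
      bilinearSum W A f g ≤ C * eLpNorm f 2 rootMeasure * eLpNorm g 2 rootMeasure

end MatrixBET

end

/-! The upper bound rests on a scalar reduction followed by a Bellman-function argument. Since `‖√A
v‖² ≤ tr A ‖v‖²`, the matrices `A_Q` may be replaced by their traces `a_Q`, which form a scalar
Carleson sequence of intensity `d M`. Write `λ(x) = ‖W(x)⁻¹‖⁻¹` for the smallest eigenvalue of
`W(x)`. Then `W ≥ λ`, and `[W]_{C_2} ≤ κ` gives `W⁻¹ ≥ κ⁻¹ λ⁻¹`. With `h = √λ` and `h' = 1/h`,
factor `a_Q² = ρ_Q σ_Q`, where `ρ_Q = a_Q ⟨h⟩/⟨h'⟩` and `σ_Q = a_Q ⟨h'⟩/⟨h⟩`. Since `⟨h⟩⟨h'⟩ ≥ 1`,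
`ρ_Q ≤ a_Q ⟨h⟩²`, so the unweighted embedding makes `ρ` Carleson with respect to `λ`, and `σ`
Carleson with respect to `λ⁻¹` (`treeSum_mul_avg_div_avg_le`). Cauchy–Schwarz splits the bilinear
sum into one sum weighted by `ρ` and one by `σ`, each controlled by the matrix-weighted embedding
`IsMatrixWeight.treeSum_le`. Only the second costs a factor `κ`, which becomes `√κ`.

Both embeddings are instances of `treeSum_mul_sq_norm_le`. Its Bellman function is `⟨(U + μ)⁻¹ X,
X⟩`, with `μ` the Carleson mass below an interval; its joint convexity as a supremum of affine
functions gives the required gain at each node.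

For necessity, a Carleson sequence with one nonzero term is tested on `1_Q W^{1/2} e` and `1_Q
W^{-1/2} e'`; letting `Q` shrink to a Lebesgue point gives `‖W^{1/2}‖ ‖W^{-1/2}‖ ≤ C` almost
everywhere. The negative results then only need conditioning numbers. The constant weight `diag(κ,
1, …, 1)` has `[W]_{A_2} = 1` and `[W]_{C_2} = κ`, while `diag(√x, 1, …, 1)` is an `A_2` weight with
unbounded conditioning. -/

noncomputable section

namespace MatrixBET

variable {d : ℕ}

/-! ### Combinatorics of the dyadic tree and sums over it. -/

namespace DyadicInterval

theorem ext_val {Q R : DyadicInterval} (h : Q.level = R.level) (h' : (Q.index : ℕ) = R.index) :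
    Q = R := by
  obtain ⟨n, k⟩ := Q
  obtain ⟨m, j⟩ := R
  obtain rfl : n = m := h
  obtain rfl : k = j := Fin.ext h'
  rfl

/-- The left half of a dyadic interval. -/
def left (Q : DyadicInterval) : DyadicInterval :=
  ⟨Q.level + 1, ⟨2 * Q.index, by have := Q.index.isLt; rw [pow_succ]; omega⟩⟩

/-- The right half of a dyadic interval. -/
def right (Q : DyadicInterval) : DyadicInterval :=
  ⟨Q.level + 1, ⟨2 * Q.index + 1, by have := Q.index.isLt; rw [pow_succ]; omega⟩⟩

theorem length_pos (Q : DyadicInterval) : 0 < Q.length := by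
  unfold length; positivity

/-- Turns inclusion of real intervals into integer arithmetic on levels and indices, so that all
later tree facts are decidable by counting. -/
theorem mem_descendants_iff {Q R : DyadicInterval} :
    R ∈ Q.descendants ↔ ∃ t, R.level = Q.level + t ∧ (Q.index : ℕ) * 2 ^ t ≤ R.index ∧
      (R.index : ℕ) < (Q.index + 1) * 2 ^ t := by
  obtain ⟨n, k, hk⟩ := Q
  obtain ⟨m, j, hj⟩ := R
  have hn : (0 : ℝ) < 2 ^ n := by positivity
  have hm : (0 : ℝ) < 2 ^ m := by positivity
  have h1 : (⟨m, j, hj⟩ : DyadicInterval) ∈ (⟨n, k, hk⟩ : DyadicInterval).descendants ↔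
      k * 2 ^ m ≤ j * 2 ^ n ∧ (j + 1) * 2 ^ n ≤ (k + 1) * 2 ^ m := by
    simp only [descendants, toSet, Set.mem_ofPred_eq]
    rw [Set.Ico_subset_Ico_iff (by gcongr; linarith), div_le_div_iff₀ hn hm,
      div_le_div_iff₀ hm hn]
    norm_cast
  rw [h1]
  constructor
  · rintro ⟨h2, h3⟩
    have h4 : n ≤ m := by
      by_contra! hlt
      have : 2 ^ m < 2 ^ n := Nat.pow_lt_pow_right (by norm_num) hlt
      nlinarith
    obtain ⟨t, rfl⟩ := Nat.exists_eq_add_of_le h4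
    have hp : 0 < 2 ^ n := by positivity
    refine ⟨t, rfl, ?_, ?_⟩
    · refine Nat.le_of_mul_le_mul_right ?_ hp
      rw [pow_add] at h2
      simp only
      linarith
    · refine Nat.le_of_mul_le_mul_right ?_ hp
      rw [pow_add] at h3
      simp only [Nat.succ_eq_add_one]
      linarith
  · rintro ⟨t, ht, h2, h3⟩
    simp only at ht h2 h3
    subst ht
    have hp : 0 < 2 ^ n := by positivity
    rw [pow_add]
    constructor
    · nlinarith
    · nlinarith

theorem level_le_of_mem_descendants {Q R : DyadicInterval} (h : R ∈ Q.descendants) :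
    Q.level ≤ R.level := by
  obtain ⟨t, h, -⟩ := mem_descendants_iff.1 h
  omega

theorem mem_descendants_iff_children {Q R : DyadicInterval} :
    R ∈ Q.descendants ↔ R = Q ∨ R ∈ Q.left.descendants ∨ R ∈ Q.right.descendants := by
  simp only [mem_descendants_iff, left, right]
  constructor
  · rintro ⟨t, h1, h2, h3⟩
    rcases t with _ | t
    · left
      exact ext_val (by simpa using h1) (by omega)
    · right
      have e1 : (Q.index : ℕ) * 2 ^ (t + 1) = 2 * Q.index * 2 ^ t := by ring
      have e2 : ((Q.index : ℕ) + 1) * 2 ^ (t + 1) = (2 * Q.index + 1 + 1) * 2 ^ t := by ring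
      rw [e1] at h2
      rw [e2] at h3
      rcases lt_or_ge (R.index : ℕ) ((2 * Q.index + 1) * 2 ^ t) with h | h
      · exact Or.inl ⟨t, by omega, h2, h⟩
      · exact Or.inr ⟨t, by omega, h, h3⟩
  · rintro (rfl | ⟨t, h1, h2, h3⟩ | ⟨t, h1, h2, h3⟩)
    · exact ⟨0, by simp⟩
    · refine ⟨t + 1, by omega, ?_, ?_⟩
      · calc _ = 2 * (Q.index : ℕ) * 2 ^ t := by ring
          _ ≤ _ := h2
      · refine h3.trans_le ?_
        rw [pow_succ']
        nlinarith
    · refine ⟨t + 1, by omega, ?_, ?_⟩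
      · refine le_trans ?_ h2
        rw [pow_succ']
        nlinarith
      · calc _ < _ := h3
          _ = _ := by ring

theorem disjoint_descendants_children (Q : DyadicInterval) :
    Disjoint Q.left.descendants Q.right.descendants := by
  rw [Set.disjoint_left]
  intro R h1 h2
  obtain ⟨t, h1, -, h3⟩ := mem_descendants_iff.1 h1
  obtain ⟨s, h4, h5, -⟩ := mem_descendants_iff.1 h2
  simp only [left, right] at h1 h3 h4 h5
  obtain rfl : s = t := by omega
  omega

theorem self_notMem_descendants_left (Q : DyadicInterval) : Q ∉ Q.left.descendants := fun h => by
  have := level_le_of_mem_descendants h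
  simp [left] at this

theorem self_notMem_descendants_right (Q : DyadicInterval) : Q ∉ Q.right.descendants := fun h => by
  have := level_le_of_mem_descendants h
  simp [right] at this

theorem toSet_eq_union (Q : DyadicInterval) : Q.toSet = Q.left.toSet ∪ Q.right.toSet := by
  simp only [toSet, left, right]
  have h : (0 : ℝ) < 2 ^ Q.level := by positivity
  have e1 : ((Q.index : ℕ) : ℝ) / 2 ^ Q.level = ((2 * Q.index : ℕ) : ℝ) / 2 ^ (Q.level + 1) := by
    push_cast; field_simp; ring
  have e2 : (((Q.index : ℕ) : ℝ) + 1) / 2 ^ Q.level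
      = (((2 * Q.index + 1 : ℕ) : ℝ) + 1) / 2 ^ (Q.level + 1) := by
    push_cast; field_simp; ring
  rw [e1, e2, show (((2 * Q.index + 1 : ℕ) : ℝ)) = ((2 * Q.index : ℕ) : ℝ) + 1 by push_cast; ring,
    Set.Ico_union_Ico_eq_Ico] <;> gcongr <;> linarith

theorem disjoint_toSet_children (Q : DyadicInterval) : Disjoint Q.left.toSet Q.right.toSet := by
  simp only [toSet, left, right]
  rw [Set.Ico_disjoint_Ico]
  push_cast
  exact (min_le_left _ _).trans (le_max_right _ _)

theorem measurableSet_toSet (Q : DyadicInterval) : MeasurableSet Q.toSet := measurableSet_Ico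

theorem toSet_subset_root (Q : DyadicInterval) : Q.toSet ⊆ Set.Ico 0 1 := by
  refine Set.Ico_subset_Ico (by positivity) ?_
  rw [div_le_one (by positivity)]
  exact_mod_cast Q.index.isLt

/-- The sum of `β` over all dyadic subintervals of `K`. -/
def treeSum (β : DyadicInterval → ℝ≥0∞) (K : DyadicInterval) : ℝ≥0∞ :=
  ∑' Q, K.descendants.indicator β Q

theorem treeSum_eq_add_children (β : DyadicInterval → ℝ≥0∞) (K : DyadicInterval) :
    treeSum β K = β K + (treeSum β K.left + treeSum β K.right) := by
  have h : K.descendants.indicator β = fun Q => ({K} : Set DyadicInterval).indicator β Q +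
      (K.left.descendants.indicator β Q + K.right.descendants.indicator β Q) := by
    have e : K.descendants = {K} ∪ (K.left.descendants ∪ K.right.descendants) := by
      ext R
      rw [mem_descendants_iff_children]
      rfl
    rw [e, Set.indicator_union_of_disjoint, Set.indicator_union_of_disjoint
      (disjoint_descendants_children K)]
    rw [Set.disjoint_singleton_left, Set.mem_union]
    exact not_or.2 ⟨self_notMem_descendants_left K, self_notMem_descendants_right K⟩
  rw [treeSum, h, ENNReal.tsum_add, ENNReal.tsum_add, tsum_eq_single K]
  · simp [treeSum]
  · intro R hR
    simp [hR]

theorem treeSum_mono {β γ : DyadicInterval → ℝ≥0∞} (h : ∀ Q, β Q ≤ γ Q) (K : DyadicInterval) :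
    treeSum β K ≤ treeSum γ K :=
  ENNReal.tsum_le_tsum fun Q => Set.indicator_le_indicator (h Q)

theorem treeSum_const_mul (c : ℝ≥0∞) (β : DyadicInterval → ℝ≥0∞) (K : DyadicInterval) :
    treeSum (fun Q => c * β Q) K = c * treeSum β K := by
  rw [treeSum, treeSum, ← ENNReal.tsum_mul_left]
  congr 1
  ext Q
  by_cases h : Q ∈ K.descendants <;> simp [h]

/-- Summation over the dyadic tree of a discrete differential inequality. -/
theorem treeSum_le_of_add_le {β h μ : DyadicInterval → ℝ} (hβ : ∀ Q, 0 ≤ β Q) (h0 : ∀ Q, 0 ≤ h Q)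
    (hμ : ∀ Q, μ Q = μ Q.left + μ Q.right) (hh : ∀ Q, h Q ≤ μ Q)
    (hle : ∀ Q, h Q + β Q ≤ h Q.left + h Q.right) (K : DyadicInterval) :
    treeSum (fun Q => ENNReal.ofReal (β Q)) K ≤ ENNReal.ofReal (μ K) := by
  -- Truncating at level `N` makes the recursion terminate: `t` bounds the number of generations
  -- left below `K`. Keeping `h K` on the left lets the gains telescope.
  have key : ∀ (N t : ℕ) (K : DyadicInterval), N ≤ K.level + t →
      treeSum (fun Q => if Q.level < N then ENNReal.ofReal (β Q) else 0) K + ENNReal.ofReal (h K)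
        ≤ ENNReal.ofReal (μ K) := by
    intro N t
    induction t with
    | zero =>
      intro K hK
      have : treeSum (fun Q => if Q.level < N then ENNReal.ofReal (β Q) else 0) K = 0 := by
        rw [treeSum, ENNReal.tsum_eq_zero]
        intro Q
        by_cases hQ : Q ∈ K.descendants
        · have := level_le_of_mem_descendants hQ
          rw [Set.indicator_of_mem hQ, if_neg (by omega)]
        · simp [hQ]
      rw [this, zero_add]
      exact ENNReal.ofReal_le_ofReal (hh K)
    | succ t ih =>
      intro K hK
      have hL := ih K.left (by simp only [left]; omega)
      have hR := ih K.right (by simp only [right]; omega)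
      rw [treeSum_eq_add_children]
      set TL := treeSum (fun Q => if Q.level < N then ENNReal.ofReal (β Q) else 0) K.left
      set TR := treeSum (fun Q => if Q.level < N then ENNReal.ofReal (β Q) else 0) K.right
      have h1 : (if K.level < N then ENNReal.ofReal (β K) else 0) ≤ ENNReal.ofReal (β K) := by
        split_ifs <;> simp
      calc _ ≤ ENNReal.ofReal (β K) + (TL + TR) + ENNReal.ofReal (h K) := by gcongr
        _ = (ENNReal.ofReal (h K) + ENNReal.ofReal (β K)) + (TL + TR) := by ring
        _ = ENNReal.ofReal (h K + β K) + (TL + TR) := by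
          rw [ENNReal.ofReal_add (h0 K) (hβ K)]
        _ ≤ ENNReal.ofReal (h K.left + h K.right) + (TL + TR) := by
          gcongr ENNReal.ofReal ?_ + _
          exact hle K
        _ = (TL + ENNReal.ofReal (h K.left)) + (TR + ENNReal.ofReal (h K.right)) := by
          rw [ENNReal.ofReal_add (h0 _) (h0 _)]
          ring
        _ ≤ ENNReal.ofReal (μ K.left) + ENNReal.ofReal (μ K.right) := by gcongr
        _ = _ := by
          rw [hμ K, ENNReal.ofReal_add ((h0 _).trans (hh _)) ((h0 _).trans (hh _))]
  rw [treeSum, ENNReal.tsum_eq_iSup_sum]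
  refine iSup_le fun s => ?_
  set N := s.sup level + 1
  refine le_trans ?_ ((le_add_right le_rfl).trans (key N N K (by omega)))
  rw [treeSum]
  refine le_trans (Finset.sum_le_sum fun Q hQ => ?_) (ENNReal.sum_le_tsum s)
  have h1 : Q.level < N := Nat.lt_succ_of_le (Finset.le_sup hQ)
  by_cases h2 : Q ∈ K.descendants <;> simp [h2, h1]

/-! ### The abstract weighted Carleson embedding via a Bellman function. -/

section Embedding

variable {𝕜 E : Type*} [RCLike 𝕜] [NormedAddCommGroup E] [InnerProductSpace 𝕜 E]
  [FiniteDimensional 𝕜 E]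

/-- **Weighted Carleson embedding**, for operators `U Q` and vectors `X Q` that are additive on the
dyadic tree, and scalar Carleson sequences `α`. -/
theorem treeSum_mul_sq_norm_le {α φ : DyadicInterval → ℝ} {U : DyadicInterval → E →ₗ[𝕜] E}
    {X z : DyadicInterval → E} (hα : ∀ Q, 0 ≤ α Q)
    (hfin : ∀ Q, treeSum (fun R => ENNReal.ofReal (α R)) Q ≠ ∞)
    (hU : ∀ Q, U Q = U Q.left + U Q.right) (hX : ∀ Q, X Q = X Q.left + X Q.right)
    (hφ : ∀ Q, φ Q = φ Q.left + φ Q.right)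
    (hsymm : ∀ Q, (U Q).IsSymmetric)
    (hpos : ∀ Q v, v ≠ 0 → 0 < RCLike.re (inner 𝕜 (U Q v) v))
    (hcar : ∀ Q v, (treeSum (fun R => ENNReal.ofReal (α R)) Q).toReal * ‖v‖ ^ 2
      ≤ RCLike.re (inner 𝕜 (U Q v) v))
    (hle : ∀ Q v, 2 * RCLike.re (inner 𝕜 (X Q) v) - RCLike.re (inner 𝕜 (U Q v) v) ≤ φ Q)
    (hz : ∀ Q, U Q (z Q) = X Q) (K : DyadicInterval) :
    treeSum (fun Q => ENNReal.ofReal (α Q * ‖z Q‖ ^ 2)) K ≤ ENNReal.ofReal (4 * φ K) := by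
  set μ : DyadicInterval → ℝ := fun Q => (treeSum (fun R => ENNReal.ofReal (α R)) Q).toReal with hμ
  have hμ0 : ∀ Q, 0 ≤ μ Q := fun Q => ENNReal.toReal_nonneg
  have hμadd : ∀ Q, μ Q = α Q + (μ Q.left + μ Q.right) := by
    intro Q
    simp only [hμ]
    rw [treeSum_eq_add_children, ENNReal.toReal_add ENNReal.ofReal_ne_top
      (ENNReal.add_ne_top.2 ⟨hfin _, hfin _⟩), ENNReal.toReal_add (hfin _) (hfin _),
      ENNReal.toReal_ofReal (hα Q)]
  have hnn : ∀ Q v, 0 ≤ RCLike.re (inner 𝕜 (U Q v) v) := by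
    intro Q v
    exact (mul_nonneg (hμ0 Q) (sq_nonneg _)).trans (hcar Q v)
  -- Adding the Carleson mass creates the gain: `V` fails to be additive on the tree by exactly `α
  -- Q`.
  set V : DyadicInterval → E →ₗ[𝕜] E := fun Q => U Q + ((μ Q : ℝ) : 𝕜) • LinearMap.id with hV
  have hVre : ∀ Q v, RCLike.re (inner 𝕜 (V Q v) v)
      = RCLike.re (inner 𝕜 (U Q v) v) + μ Q * ‖v‖ ^ 2 := by
    intro Q v
    simp only [hV, LinearMap.add_apply, LinearMap.smul_apply, LinearMap.id_apply, inner_add_left,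
      inner_smul_left, map_add, RCLike.conj_ofReal, RCLike.re_ofReal_mul, inner_self_eq_norm_sq]
  have hVsymm : ∀ Q v w, inner 𝕜 (V Q v) w = inner 𝕜 v (V Q w) := by
    intro Q v w
    simp only [hV, LinearMap.add_apply, LinearMap.smul_apply, LinearMap.id_apply, inner_add_left,
      inner_smul_left, inner_add_right, inner_smul_right, RCLike.conj_ofReal]
    rw [hsymm Q v w]
  have hVsurj : ∀ Q, ∃ y, V Q y = X Q := by
    intro Q
    refine LinearMap.surjective_of_injective (f := V Q) ?_ (X Q)
    rw [injective_iff_map_eq_zero]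
    intro v hv
    by_contra hne
    have := hVre Q v
    rw [hv, inner_zero_left, map_zero] at this
    have h1 := hpos Q v hne
    have h2 := mul_nonneg (hμ0 Q) (sq_nonneg ‖v‖)
    linarith
  choose y hy using hVsurj
  set h : DyadicInterval → ℝ := fun Q => RCLike.re (inner 𝕜 (X Q) (y Q)) with hh
  have hhV : ∀ Q, h Q = RCLike.re (inner 𝕜 (V Q (y Q)) (y Q)) := fun Q => by rw [hy]
  -- Variational form of `h = ⟨V⁻¹ X, X⟩`, attained at `v = y Q`; it follows by completing the
  -- square around `y Q`.
  have hvar : ∀ Q v, 2 * RCLike.re (inner 𝕜 (X Q) v) - RCLike.re (inner 𝕜 (V Q v) v) ≤ h Q := by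
    intro Q v
    have h1 : 0 ≤ RCLike.re (inner 𝕜 (V Q (v - y Q)) (v - y Q)) := by
      rw [hVre]
      exact add_nonneg (hnn _ _) (mul_nonneg (hμ0 Q) (sq_nonneg _))
    have h2 : RCLike.re (inner 𝕜 (V Q v) (y Q)) = RCLike.re (inner 𝕜 (X Q) v) := by
      rw [hVsymm, hy, ← inner_conj_symm, RCLike.conj_re]
    rw [map_sub, inner_sub_left, inner_sub_right, inner_sub_right, hy, map_sub, map_sub, map_sub,
      h2] at h1
    simp only [hh]
    linarith
  -- Passing from `V⁻¹ X` back to `U⁻¹ X` costs only a factor 2: `U (z - y) = μ y` and `U ≥ μ` force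
  -- `‖z - y‖ ≤ ‖y‖`.
  have hzy : ∀ Q, ‖z Q‖ ≤ 2 * ‖y Q‖ := by
    intro Q
    have h1 : U Q (z Q - y Q) = ((μ Q : ℝ) : 𝕜) • y Q := by
      rw [map_sub, hz, ← hy]
      simp [hV]
    have h2 : ‖z Q - y Q‖ ≤ ‖y Q‖ := by
      by_cases hne : z Q - y Q = 0
      · rw [hne, norm_zero]; exact norm_nonneg _
      have h3 := hpos Q _ hne
      have h4 := hcar Q (z Q - y Q)
      have h5 : RCLike.re (inner 𝕜 (U Q (z Q - y Q)) (z Q - y Q))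
          ≤ μ Q * (‖y Q‖ * ‖z Q - y Q‖) := by
        rw [h1, inner_smul_left, RCLike.conj_ofReal, RCLike.re_ofReal_mul]
        exact mul_le_mul_of_nonneg_left (re_inner_le_norm _ _) (hμ0 Q)
      have h6 : 0 < μ Q := by
        rcases (hμ0 Q).eq_or_lt with h | h
        · rw [← h, zero_mul] at h5
          linarith
        · exact h
      have h7 : ‖z Q - y Q‖ ^ 2 ≤ ‖y Q‖ * ‖z Q - y Q‖ :=
        le_of_mul_le_mul_left (h4.trans h5) h6
      rw [sq] at h7
      exact le_of_mul_le_mul_right h7 (norm_pos_iff.2 hne)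
    calc ‖z Q‖ = ‖(z Q - y Q) + y Q‖ := by rw [sub_add_cancel]
      _ ≤ ‖z Q - y Q‖ + ‖y Q‖ := norm_add_le _ _
      _ ≤ _ := by linarith
  have main := treeSum_le_of_add_le (β := fun Q => α Q * ‖y Q‖ ^ 2) (h := h) (μ := φ)
    (fun Q => mul_nonneg (hα Q) (sq_nonneg _))
    (fun Q => by
      rw [hhV, hVre]
      exact add_nonneg (hnn _ _) (mul_nonneg (hμ0 Q) (sq_nonneg _))) hφ
    (fun Q => by
      have h1 := hle Q (y Q)
      have h2 := hhV Q
      rw [hVre] at h2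
      have h3 := mul_nonneg (hμ0 Q) (sq_nonneg ‖y Q‖)
      simp only [hh] at h2 ⊢
      linarith)
    -- The maximizer `y Q` of the parent is used as a trial vector in both children; the defect of
    -- `V` yields `α Q * ‖y Q‖ ^ 2`.
    (fun Q => by
      have h1 := hvar Q.left (y Q)
      have h2 := hvar Q.right (y Q)
      have h3 := hhV Q
      have h4 : h Q = RCLike.re (inner 𝕜 (X Q.left) (y Q)) +
          RCLike.re (inner 𝕜 (X Q.right) (y Q)) := by
        simp only [hh]
        rw [hX Q, inner_add_left, map_add]
      rw [hVre] at h1 h2 h3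
      rw [hU Q, LinearMap.add_apply, inner_add_left, map_add, hμadd Q] at h3
      linarith) K
  calc _ ≤ treeSum (fun Q => ENNReal.ofReal 4 * ENNReal.ofReal (α Q * ‖y Q‖ ^ 2)) K := by
        refine treeSum_mono (fun Q => ?_) K
        rw [← ENNReal.ofReal_mul (by norm_num)]
        refine ENNReal.ofReal_le_ofReal ?_
        have h1 : ‖z Q‖ ^ 2 ≤ 4 * ‖y Q‖ ^ 2 := by
          have := pow_le_pow_left₀ (norm_nonneg _) (hzy Q) 2
          linarith [mul_pow 2 ‖y Q‖ 2]
        nlinarith [mul_le_mul_of_nonneg_left h1 (hα Q)]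
    _ = ENNReal.ofReal 4 * treeSum (fun Q => ENNReal.ofReal (α Q * ‖y Q‖ ^ 2)) K :=
        treeSum_const_mul _ _ _
    _ ≤ ENNReal.ofReal 4 * ENNReal.ofReal (φ K) := by gcongr
    _ = _ := by rw [← ENNReal.ofReal_mul (by norm_num)]

end Embedding

end DyadicInterval

/-! ### Dyadic averages and the scalar Carleson embedding. -/

namespace DyadicInterval

theorem length_left (Q : DyadicInterval) : Q.left.length = Q.length / 2 := by
  simp only [length, left, pow_succ]
  ring

theorem length_right (Q : DyadicInterval) : Q.right.length = Q.length / 2 := by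
  simp only [length, right, pow_succ]
  ring

theorem length_eq_add (Q : DyadicInterval) : Q.length = Q.left.length + Q.right.length := by
  rw [length_left, length_right]
  ring

theorem volume_real_toSet (Q : DyadicInterval) : volume.real Q.toSet = Q.length := by
  rw [Measure.real, volume_toSet, ENNReal.toReal_ofReal (length_pos Q).le]

theorem volume_toSet_ne_top (Q : DyadicInterval) : volume Q.toSet ≠ ∞ := by
  rw [volume_toSet]
  exact ENNReal.ofReal_ne_top

theorem restrict_toSet_le (Q : DyadicInterval) : volume.restrict Q.toSet ≤ rootMeasure :=
  Measure.restrict_mono (toSet_subset_root Q) le_rfl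

theorem ae_toSet {p : ℝ → Prop} (h : ∀ᵐ x ∂rootMeasure, p x) (Q : DyadicInterval) :
    ∀ᵐ x ∂volume.restrict Q.toSet, p x :=
  ae_mono (restrict_toSet_le Q) h

instance (Q : DyadicInterval) : IsFiniteMeasure (volume.restrict Q.toSet) :=
  ⟨by rw [Measure.restrict_apply_univ]; exact (volume_toSet_ne_top Q).lt_top⟩

instance (Q : DyadicInterval) : NeZero (volume.restrict Q.toSet) :=
  ⟨by
    rw [Ne, Measure.restrict_eq_zero, volume_toSet, ENNReal.ofReal_eq_zero, not_le]
    exact length_pos Q⟩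

section

variable {F : Type*} [NormedAddCommGroup F]

theorem integrableOn_toSet {f : ℝ → F} (hf : Integrable f rootMeasure) (Q : DyadicInterval) :
    IntegrableOn f Q.toSet :=
  hf.mono_measure (restrict_toSet_le Q)

variable [NormedSpace ℝ F]

theorem setIntegral_eq_add {f : ℝ → F} (hf : Integrable f rootMeasure) (Q : DyadicInterval) :
    ∫ x in Q.toSet, f x = (∫ x in Q.left.toSet, f x) + ∫ x in Q.right.toSet, f x := by
  rw [toSet_eq_union Q, setIntegral_union (disjoint_toSet_children Q) (measurableSet_toSet _)
    (integrableOn_toSet hf _) (integrableOn_toSet hf _)]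

theorem avg_eq_smul (Q : DyadicInterval) (f : ℝ → F) :
    avg Q f = Q.length⁻¹ • ∫ x in Q.toSet, f x := by
  rw [avg, setAverage_eq, volume_real_toSet]

theorem setIntegral_eq_length_smul_avg (Q : DyadicInterval) (f : ℝ → F) :
    ∫ x in Q.toSet, f x = Q.length • avg Q f := by
  rw [avg_eq_smul, smul_inv_smul₀ (length_pos Q).ne']

end

theorem setIntegral_pos {f : ℝ → ℝ} (hf : Integrable f rootMeasure)
    (h : ∀ᵐ x ∂rootMeasure, 0 < f x) (Q : DyadicInterval) : 0 < ∫ x in Q.toSet, f x := by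
  have h' := ae_toSet h Q
  rw [integral_pos_iff_support_of_nonneg_ae (h'.mono fun x hx => hx.le) (integrableOn_toSet hf Q)]
  have : (Function.support f : Set ℝ) =ᵐ[volume.restrict Q.toSet] Set.univ := by
    filter_upwards [h'] with x hx
    exact eq_true hx.ne'
  rw [measure_congr this]
  exact Measure.measure_univ_pos.2 (NeZero.ne _)

theorem avg_pos {f : ℝ → ℝ} (hf : Integrable f rootMeasure)
    (h : ∀ᵐ x ∂rootMeasure, 0 < f x) (Q : DyadicInterval) : 0 < avg Q f := by
  rw [avg_eq_smul]
  exact mul_pos (inv_pos.2 (length_pos Q)) (setIntegral_pos hf h Q)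

/-- The unweighted dyadic Carleson embedding theorem. -/
theorem treeSum_mul_sq_avg_le {a : DyadicInterval → ℝ} {m : ℝ} (hm : 0 < m) (ha : ∀ Q, 0 ≤ a Q)
    (hcar : ∀ Q, treeSum (fun R => ENNReal.ofReal (a R)) Q ≤ ENNReal.ofReal (m * Q.length))
    {h : ℝ → ℝ} (hint : Integrable h rootMeasure) (hsq : Integrable (fun x => h x ^ 2) rootMeasure)
    (K : DyadicInterval) :
    treeSum (fun Q => ENNReal.ofReal (a Q * avg Q h ^ 2)) K
      ≤ ENNReal.ofReal (4 * m * ∫ x in K.toSet, h x ^ 2) := by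
  -- One-dimensional case with the constant weight `m`, chosen so that `U Q = m |Q|` dominates the
  -- Carleson mass; the solution `z` is then `m⁻¹` times the average.
  have key := treeSum_mul_sq_norm_le (𝕜 := ℝ) (E := ℝ) (α := a)
    (φ := fun Q => m⁻¹ * ∫ x in Q.toSet, h x ^ 2)
    (U := fun Q => (m * Q.length) • LinearMap.id) (X := fun Q => ∫ x in Q.toSet, h x)
    (z := fun Q => m⁻¹ * avg Q h) ha
    (fun Q => ne_top_of_le_ne_top ENNReal.ofReal_ne_top (hcar Q))
    (fun Q => by rw [← add_smul, ← mul_add, ← length_eq_add])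
    (fun Q => setIntegral_eq_add hint Q)
    (fun Q => by rw [setIntegral_eq_add hsq Q, mul_add])
    (fun Q v w => by simp [mul_comm, mul_left_comm])
    (fun Q v hv => by
      have := length_pos Q
      simp only [LinearMap.smul_apply, LinearMap.id_apply, inner_smul_left, RCLike.re_to_real,
        real_inner_self_eq_norm_sq, conj_trivial]
      positivity)
    (fun Q v => by
      simp only [LinearMap.smul_apply, LinearMap.id_apply, inner_smul_left, RCLike.re_to_real,
        real_inner_self_eq_norm_sq, conj_trivial]
      refine mul_le_mul_of_nonneg_right ?_ (sq_nonneg _)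
      exact ENNReal.toReal_le_of_le_ofReal (mul_nonneg hm.le (length_pos Q).le) (hcar Q))
    (fun Q v => by
      simp only [LinearMap.smul_apply, LinearMap.id_apply, inner_smul_left, RCLike.re_to_real,
        real_inner_self_eq_norm_sq, conj_trivial, Real.norm_eq_abs, sq_abs]
      rw [real_inner_eq_re_inner, RCLike.re_to_real]
      simp only [RCLike.inner_apply, conj_trivial]
      have h1 : m * Q.length * v ^ 2 = ∫ x in Q.toSet, m * v ^ 2 := by
        rw [setIntegral_const, volume_real_toSet, smul_eq_mul]; ring
      have h2 : 2 * (v * ∫ x in Q.toSet, h x) = ∫ x in Q.toSet, (2 * v) * h x := by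
        rw [integral_const_mul]; ring
      rw [h1, h2, ← integral_sub ((integrableOn_toSet hint Q).const_mul _)
        (integrable_const _), ← integral_const_mul]
      refine integral_mono (((integrableOn_toSet hint Q).const_mul _).sub (integrable_const _))
        ((integrableOn_toSet hsq Q).const_mul _) fun x => ?_
      simp only
      have h3 : m⁻¹ * h x ^ 2 - (2 * v * h x - m * v ^ 2) = m⁻¹ * (h x - m * v) ^ 2 := by
        field_simp
        ring
      have h4 : 0 ≤ m⁻¹ * (h x - m * v) ^ 2 := by positivity
      linarith)
    (fun Q => by
      simp only [LinearMap.smul_apply, LinearMap.id_apply, smul_eq_mul]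
      rw [setIntegral_eq_length_smul_avg, smul_eq_mul]
      field_simp) K
  calc _ = treeSum (fun Q => ENNReal.ofReal (m ^ 2) *
          ENNReal.ofReal (a Q * ‖m⁻¹ * avg Q h‖ ^ 2)) K := by
        congr 1
        ext Q
        rw [← ENNReal.ofReal_mul (by positivity), Real.norm_eq_abs, sq_abs]
        congr 1
        field_simp
    _ = ENNReal.ofReal (m ^ 2) * treeSum (fun Q =>
          ENNReal.ofReal (a Q * ‖m⁻¹ * avg Q h‖ ^ 2)) K := treeSum_const_mul _ _ _
    _ ≤ ENNReal.ofReal (m ^ 2) * ENNReal.ofReal (4 * (m⁻¹ * ∫ x in K.toSet, h x ^ 2)) := by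
        gcongr
    _ = _ := by
        rw [← ENNReal.ofReal_mul (by positivity)]
        congr 1
        field_simp

/-- The ratio of the averages of `√w` and `1 / √w` is a multiplier that is Carleson
with respect to `w`. -/
theorem treeSum_mul_avg_div_avg_le {a : DyadicInterval → ℝ} {m : ℝ} (hm : 0 < m)
    (ha : ∀ Q, 0 ≤ a Q)
    (hcar : ∀ Q, treeSum (fun R => ENNReal.ofReal (a R)) Q ≤ ENNReal.ofReal (m * Q.length))
    {h h' : ℝ → ℝ} (hint : Integrable h rootMeasure) (hint' : Integrable h' rootMeasure)
    (hsq : Integrable (fun x => h x ^ 2) rootMeasure)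
    (hpos : ∀ᵐ x ∂rootMeasure, 0 < h x) (hmul : ∀ᵐ x ∂rootMeasure, h x * h' x = 1)
    (K : DyadicInterval) :
    treeSum (fun Q => ENNReal.ofReal (a Q * (avg Q h / avg Q h'))) K
      ≤ ENNReal.ofReal (4 * m * ∫ x in K.toSet, h x ^ 2) := by
  refine (treeSum_mono (fun Q => ENNReal.ofReal_le_ofReal ?_) K).trans
    (treeSum_mul_sq_avg_le hm ha hcar hint hsq K)
  refine mul_le_mul_of_nonneg_left ?_ (ha Q)
  have hP := avg_pos hint hpos Q
  have hR : 0 < avg Q h' := by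
    refine avg_pos hint' ?_ Q
    filter_upwards [hpos, hmul] with x h1 h2
    exact pos_of_mul_pos_right (h2 ▸ one_pos) h1.le
  set P := avg Q h with hPdef
  set R := avg Q h' with hRdef
  -- Integrating `h / P + P / h ≥ 2` gives `1 + P R ≥ 2`, hence `P R ≥ 1` and `P / R ≤ P ^ 2`.
  have h1 : 2 * Q.length ≤ P⁻¹ * (∫ x in Q.toSet, h x) + P * ∫ x in Q.toSet, h' x := by
    rw [← integral_const_mul, ← integral_const_mul, ← integral_add
      ((integrableOn_toSet hint Q).const_mul _) ((integrableOn_toSet hint' Q).const_mul _)]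
    have : 2 * Q.length = ∫ x in Q.toSet, (2 : ℝ) := by
      rw [setIntegral_const, volume_real_toSet, smul_eq_mul, mul_comm]
    rw [this]
    refine integral_mono_ae (integrable_const _) (((integrableOn_toSet hint Q).const_mul _).add
      ((integrableOn_toSet hint' Q).const_mul _)) ?_
    filter_upwards [ae_toSet hpos Q, ae_toSet hmul Q] with x hx hx'
    have e : h' x = (h x)⁻¹ := eq_inv_of_mul_eq_one_right hx'
    simp only [e]
    have : P⁻¹ * h x + P * (h x)⁻¹ - 2 = (h x - P) ^ 2 / (P * h x) := by
      field_simp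
      ring
    have h3 : 0 ≤ (h x - P) ^ 2 / (P * h x) := by positivity
    linarith
  rw [setIntegral_eq_length_smul_avg, setIntegral_eq_length_smul_avg, ← hPdef, ← hRdef,
    smul_eq_mul, smul_eq_mul] at h1
  have hl := length_pos Q
  have h2 : P⁻¹ * (Q.length * P) = Q.length := by field_simp
  have h3 : 1 ≤ P * R := by
    rw [h2] at h1
    by_contra! hlt
    nlinarith
  rw [div_le_iff₀ hR]
  nlinarith

end DyadicInterval

/-! ### Matrices acting on vectors, square roots and quadratic forms. -/

theorem act_mul (M N : Matrix (Fin d) (Fin d) ℂ) (v : EuclideanSpace ℂ (Fin d)) :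
    act (M * N) v = act M (act N v) := by
  simp [act]

theorem act_one (v : EuclideanSpace ℂ (Fin d)) : act 1 v = v := by
  simp [act]

theorem act_smul_real (c : ℝ) (M : Matrix (Fin d) (Fin d) ℂ) (v : EuclideanSpace ℂ (Fin d)) :
    act (c • M) v = c • act M v := by
  rw [← Complex.coe_smul, ← Complex.coe_smul]
  simp only [act, map_smul, smul_apply]

theorem norm_act_le (M : Matrix (Fin d) (Fin d) ℂ) (v : EuclideanSpace ℂ (Fin d)) :
    ‖act M v‖ ≤ ‖M‖ * ‖v‖ :=
  (Matrix.toEuclideanCLM (n := Fin d) (𝕜 := ℂ) M).le_opNorm v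

theorem inner_act_left (M : Matrix (Fin d) (Fin d) ℂ) (v w : EuclideanSpace ℂ (Fin d)) :
    inner ℂ (act M v) w = inner ℂ v (act (star M) w) := by
  simp only [act, map_star]
  rw [ContinuousLinearMap.star_eq_adjoint, ContinuousLinearMap.adjoint_inner_right]

/-- The action on a fixed vector, as a continuous linear map of the matrix. -/
def actVec (v : EuclideanSpace ℂ (Fin d)) :
    Matrix (Fin d) (Fin d) ℂ →L[ℂ] EuclideanSpace ℂ (Fin d) :=
  LinearMap.toContinuousLinearMap
    { toFun := fun M => act M v
      map_add' := fun M N => by simp [act]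
      map_smul' := fun c M => by simp [act] }

theorem actVec_apply (v : EuclideanSpace ℂ (Fin d)) (M : Matrix (Fin d) (Fin d) ℂ) :
    actVec v M = act M v := rfl

theorem continuous_act :
    Continuous fun p : Matrix (Fin d) (Fin d) ℂ × EuclideanSpace ℂ (Fin d) => act p.1 p.2 := by
  have h : Continuous fun M : Matrix (Fin d) (Fin d) ℂ =>
      Matrix.toEuclideanCLM (n := Fin d) (𝕜 := ℂ) M :=
    (AddMonoidHomClass.isometry_of_norm _ fun M => Matrix.l2_opNorm_toEuclideanCLM M).continuous
  exact (h.comp continuous_fst).clm_apply continuous_snd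

theorem aestronglyMeasurable_act {μ : Measure ℝ} {M : ℝ → Matrix (Fin d) (Fin d) ℂ}
    {f : ℝ → EuclideanSpace ℂ (Fin d)} (hM : AEStronglyMeasurable M μ)
    (hf : AEStronglyMeasurable f μ) : AEStronglyMeasurable (fun x => act (M x) (f x)) μ := by
  have h : AEStronglyMeasurable (fun x => (M x, f x)) μ := hM.prodMk hf
  exact Continuous.comp_aestronglyMeasurable
    (g := fun p : Matrix (Fin d) (Fin d) ℂ × EuclideanSpace ℂ (Fin d) => act p.1 p.2)
    (f := fun x => (M x, f x)) continuous_act h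

/-- Serves the measurability of `√W`. Since `W` is positive only almost everywhere, the square root
is composed with `M ↦ |M|`, which is positive for every matrix and fixes the positive semidefinite
ones. -/
theorem continuous_sqrt_abs :
    Continuous fun M : Matrix (Fin d) (Fin d) ℂ => CFC.sqrt (CFC.sqrt (star M * M)) := by
  have key : ∀ f : Matrix (Fin d) (Fin d) ℂ → Matrix (Fin d) (Fin d) ℂ, Continuous f →
      (∀ M, 0 ≤ f M) → Continuous fun M => CFC.sqrt (f M) := by
    intro f hf h0
    simp only [CFC.sqrt_eq_cfc]
    exact Continuous.cfc_nnreal_of_mem_nhdsSet (s := Set.univ) NNReal.sqrt Filter.univ_mem hf h0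
      NNReal.continuous_sqrt.continuousOn
  exact key _ (key _ (by fun_prop) fun M => star_mul_self_nonneg M) fun M => CFC.sqrt_nonneg _

theorem sqrt_abs_eq {M : Matrix (Fin d) (Fin d) ℂ} (hM : M.PosSemidef) :
    CFC.sqrt (CFC.sqrt (star M * M)) = CFC.sqrt M := by
  have h0 : 0 ≤ M := Matrix.nonneg_iff_posSemidef.2 hM
  have h : star M = M := hM.isHermitian
  rw [h, CFC.sqrt_mul_self M h0]

theorem star_sqrt (M : Matrix (Fin d) (Fin d) ℂ) : star (CFC.sqrt M) = CFC.sqrt M :=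
  (Matrix.nonneg_iff_posSemidef.1 (CFC.sqrt_nonneg M)).isHermitian

theorem sqrt_mul_sqrt {M : Matrix (Fin d) (Fin d) ℂ} (hM : M.PosSemidef) :
    CFC.sqrt M * CFC.sqrt M = M :=
  CFC.sqrt_mul_sqrt_self M (Matrix.nonneg_iff_posSemidef.2 hM)

theorem norm_sqrt_sq {M : Matrix (Fin d) (Fin d) ℂ} (hM : M.PosSemidef) :
    ‖CFC.sqrt M‖ ^ 2 = ‖M‖ := by
  have h := CStarRing.norm_star_mul_self (x := CFC.sqrt M)
  rw [star_sqrt, sqrt_mul_sqrt hM] at h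
  rw [h, sq]

theorem re_inner_act_self {M : Matrix (Fin d) (Fin d) ℂ} (hM : M.PosSemidef)
    (v : EuclideanSpace ℂ (Fin d)) :
    RCLike.re (inner ℂ (act M v) v) = ‖act (CFC.sqrt M) v‖ ^ 2 := by
  conv_lhs => rw [← sqrt_mul_sqrt hM, act_mul, inner_act_left, star_sqrt]
  exact inner_self_eq_norm_sq _

theorem sqrt_inv_mul_sqrt {M : Matrix (Fin d) (Fin d) ℂ} (hM : M.PosDef) :
    CFC.sqrt M⁻¹ * CFC.sqrt M = 1 := by
  rw [← hM.posSemidef.inv_sqrt]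
  refine Matrix.nonsing_inv_mul _ ?_
  rw [← Matrix.isUnit_iff_isUnit_det]
  exact (CFC.isUnit_sqrt_iff M (Matrix.nonneg_iff_posSemidef.2 hM.posSemidef)).2 hM.isUnit

theorem sqrt_mul_sqrt_inv {M : Matrix (Fin d) (Fin d) ℂ} (hM : M.PosDef) :
    CFC.sqrt M * CFC.sqrt M⁻¹ = 1 :=
  mul_eq_one_comm.1 (sqrt_inv_mul_sqrt hM)

theorem inv_inv_of_posDef {M : Matrix (Fin d) (Fin d) ℂ} (hM : M.PosDef) : M⁻¹⁻¹ = M :=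
  Matrix.nonsing_inv_nonsing_inv _ ((Matrix.isUnit_iff_isUnit_det _).1 hM.isUnit)

/-- Writing `v = M^{-1/2} M^{1/2} v` shows that `‖M⁻¹‖⁻¹` is a lower bound for the quadratic form of
`M`. -/
theorem sq_norm_le_norm_inv_mul {M : Matrix (Fin d) (Fin d) ℂ} (hM : M.PosDef)
    (v : EuclideanSpace ℂ (Fin d)) :
    ‖v‖ ^ 2 ≤ ‖M⁻¹‖ * RCLike.re (inner ℂ (act M v) v) := by
  rw [re_inner_act_self hM.posSemidef, ← norm_sqrt_sq hM.inv.posSemidef, ← mul_pow]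
  refine pow_le_pow_left₀ (norm_nonneg _) ?_ 2
  calc ‖v‖ = ‖act (CFC.sqrt M⁻¹) (act (CFC.sqrt M) v)‖ := by
        rw [← act_mul, sqrt_inv_mul_sqrt hM, act_one]
    _ ≤ _ := norm_act_le _ _

theorem isUnit_of_re_inner_pos {M : Matrix (Fin d) (Fin d) ℂ}
    (h : ∀ v, v ≠ 0 → 0 < RCLike.re (inner ℂ (act M v) v)) : IsUnit M := by
  rw [← Matrix.mulVec_injective_iff_isUnit, ← Matrix.coe_mulVecLin, injective_iff_map_eq_zero]
  intro u hu
  by_contra hne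
  have h1 := h (WithLp.toLp 2 u) (by simpa using hne)
  rw [act, Matrix.toEuclideanCLM_toLp, ← Matrix.mulVecLin_apply, hu] at h1
  simp at h1

/-- An operator is bounded by the trace: `‖√A v‖² ≤ tr A ‖v‖²`. -/
theorem norm_act_sqrt_sq_le_trace {A : Matrix (Fin d) (Fin d) ℂ} (hA : A.PosSemidef)
    (v : EuclideanSpace ℂ (Fin d)) :
    ‖act (CFC.sqrt A) v‖ ^ 2 ≤ A.trace.re * ‖v‖ ^ 2 := by
  set B := CFC.sqrt A with hB
  -- The trace of `A` is the squared Hilbert–Schmidt norm of `√A`, which dominates the squared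
  -- operator norm by Cauchy–Schwarz in each row.
  have h1 : A.trace.re = ∑ i, ∑ j, ‖B i j‖ ^ 2 := by
    conv_lhs => rw [← sqrt_mul_sqrt hA, ← hB]
    conv_lhs => rw [show B * B = B * star B by rw [hB, star_sqrt]]
    simp only [Matrix.trace, Matrix.diag, Matrix.mul_apply, Matrix.star_apply, Complex.re_sum]
    refine Finset.sum_congr rfl fun i _ => Finset.sum_congr rfl fun j _ => ?_
    rw [← Complex.normSq_eq_norm_sq, Complex.star_def, Complex.mul_conj, Complex.ofReal_re]
  rw [h1, EuclideanSpace.norm_sq_eq, EuclideanSpace.norm_sq_eq, Finset.sum_mul]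
  refine Finset.sum_le_sum fun i _ => ?_
  have h2 : (act B v) i = ∑ j, B i j * v j := by
    simp [act, Matrix.ofLp_toEuclideanCLM, Matrix.mulVec, dotProduct]
  rw [h2]
  calc ‖∑ j, B i j * v j‖ ^ 2 ≤ (∑ j, ‖B i j‖ * ‖v j‖) ^ 2 := by
        refine pow_le_pow_left₀ (norm_nonneg _) ((norm_sum_le _ _).trans ?_) 2
        simp
    _ ≤ _ := Finset.sum_mul_sq_le_sq_mul_sq _ _ _

theorem re_trace_nonneg {A : Matrix (Fin d) (Fin d) ℂ} (hA : A.PosSemidef) : 0 ≤ A.trace.re :=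
  (Complex.le_def.1 hA.trace_nonneg).1

/-! ### Measurability and integrability for matrix weights. -/

namespace IsMatrixWeight

variable {W : ℝ → Matrix (Fin d) (Fin d) ℂ}

theorem inv (hW : IsMatrixWeight W) : IsMatrixWeight fun x => (W x)⁻¹ where
  posDef := hW.posDef.mono fun _ hx => hx.inv
  integrable := hW.integrable_inv
  integrable_inv := hW.integrable.congr (hW.posDef.mono fun _ hx => (inv_inv_of_posDef hx).symm)

theorem aestronglyMeasurable_sqrt (hW : IsMatrixWeight W) :
    AEStronglyMeasurable (fun x => CFC.sqrt (W x)) rootMeasure :=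
  (continuous_sqrt_abs.comp_aestronglyMeasurable hW.integrable.aestronglyMeasurable).congr
    (hW.posDef.mono fun _ hx => sqrt_abs_eq hx.posSemidef)

theorem memLp_sqrt (hW : IsMatrixWeight W) :
    MemLp (fun x => CFC.sqrt (W x)) 2 rootMeasure := by
  rw [memLp_two_iff_integrable_sq_norm hW.aestronglyMeasurable_sqrt]
  exact hW.integrable.norm.congr (hW.posDef.mono fun _ hx => (norm_sqrt_sq hx.posSemidef).symm)

theorem integrable_act_sqrt (hW : IsMatrixWeight W) {f : ℝ → EuclideanSpace ℂ (Fin d)}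
    (hf : MemLp f 2 rootMeasure) :
    Integrable (fun x => act (CFC.sqrt (W x)) (f x)) rootMeasure := by
  have h1 : Integrable (fun x => ‖CFC.sqrt (W x)‖ * ‖f x‖) rootMeasure :=
    hW.memLp_sqrt.norm.integrable_mul hf.norm
  have h2 : AEStronglyMeasurable (fun x => act (CFC.sqrt (W x)) (f x)) rootMeasure :=
    aestronglyMeasurable_act hW.aestronglyMeasurable_sqrt hf.aestronglyMeasurable
  exact h1.mono' h2 (ae_of_all _ fun x => norm_act_le _ _)

end IsMatrixWeight

/-! ### Quadratic forms of integrals and the matrix-weighted embedding. -/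

theorem re_inner_setIntegral {F : ℝ → EuclideanSpace ℂ (Fin d)} {μ : Measure ℝ}
    (hF : Integrable F μ) (v : EuclideanSpace ℂ (Fin d)) :
    RCLike.re (inner ℂ (∫ x, F x ∂μ) v) = ∫ x, RCLike.re (inner ℂ (F x) v) ∂μ := by
  rw [← inner_conj_symm, RCLike.conj_re, ← integral_inner hF, ← integral_re (hF.const_inner v)]
  refine integral_congr_ae (ae_of_all _ fun x => ?_)
  simp only
  rw [← inner_conj_symm, RCLike.conj_re]

theorem integrable_re_inner {F : ℝ → EuclideanSpace ℂ (Fin d)} {μ : Measure ℝ}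
    (hF : Integrable F μ) (v : EuclideanSpace ℂ (Fin d)) :
    Integrable (fun x => RCLike.re (inner ℂ (F x) v)) μ :=
  (hF.inner_const v).re

theorem act_setIntegral {W : ℝ → Matrix (Fin d) (Fin d) ℂ} {μ : Measure ℝ} (hW : Integrable W μ)
    (v : EuclideanSpace ℂ (Fin d)) : act (∫ x, W x ∂μ) v = ∫ x, act (W x) v ∂μ := by
  have := (actVec v).integral_comp_comm hW
  simpa only [actVec_apply] using this.symm

theorem integrable_act {W : ℝ → Matrix (Fin d) (Fin d) ℂ} {μ : Measure ℝ} (hW : Integrable W μ)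
    (v : EuclideanSpace ℂ (Fin d)) : Integrable (fun x => act (W x) v) μ :=
  (hW.norm.mul_const ‖v‖).mono'
    (aestronglyMeasurable_act hW.aestronglyMeasurable aestronglyMeasurable_const)
    (ae_of_all _ fun x => norm_act_le (W x) v)

theorem re_inner_act_setIntegral {W : ℝ → Matrix (Fin d) (Fin d) ℂ} {μ : Measure ℝ}
    (hW : Integrable W μ) (v : EuclideanSpace ℂ (Fin d)) :
    RCLike.re (inner ℂ (act (∫ x, W x ∂μ) v) v) = ∫ x, RCLike.re (inner ℂ (act (W x) v) v) ∂μ := by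
  rw [act_setIntegral hW, re_inner_setIntegral (integrable_act hW v)]

theorem inner_act_setIntegral_symm {W : ℝ → Matrix (Fin d) (Fin d) ℂ} {μ : Measure ℝ}
    (hW : Integrable W μ) (hsymm : ∀ᵐ x ∂μ, star (W x) = W x) (v w : EuclideanSpace ℂ (Fin d)) :
    inner ℂ (act (∫ x, W x ∂μ) v) w = inner ℂ v (act (∫ x, W x ∂μ) w) := by
  rw [act_setIntegral hW, act_setIntegral hW, ← integral_inner (integrable_act hW w),
    ← inner_conj_symm, ← integral_inner (integrable_act hW v), ← integral_conj]
  refine integral_congr_ae (hsymm.mono fun x hx => ?_)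
  simp only
  rw [inner_conj_symm, inner_act_left, hx]

namespace IsMatrixWeight

variable {W : ℝ → Matrix (Fin d) (Fin d) ℂ}

theorem re_inner_pos (hW : IsMatrixWeight W) (Q : DyadicInterval) {v : EuclideanSpace ℂ (Fin d)}
    (hv : v ≠ 0) : 0 < RCLike.re (inner ℂ (act (∫ x in Q.toSet, W x) v) v) := by
  rw [re_inner_act_setIntegral (DyadicInterval.integrableOn_toSet hW.integrable Q)]
  refine DyadicInterval.setIntegral_pos
    (integrable_re_inner (integrable_act hW.integrable v) v) (hW.posDef.mono fun x hx => ?_) Q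
  have h1 := sq_norm_le_norm_inv_mul hx v
  have h2 : 0 < ‖v‖ ^ 2 := by have := norm_pos_iff.2 hv; positivity
  exact pos_of_mul_pos_right (h2.trans_le h1) (norm_nonneg _)

theorem isUnit_avg (hW : IsMatrixWeight W) (Q : DyadicInterval) : IsUnit (avg Q W) := by
  refine isUnit_of_re_inner_pos fun v hv => ?_
  have h := hW.re_inner_pos Q hv
  rw [DyadicInterval.setIntegral_eq_length_smul_avg, act_smul_real, ← Complex.coe_smul,
    inner_smul_left, Complex.conj_ofReal] at h
  have h' : 0 < Q.length * RCLike.re (inner ℂ (act (avg Q W) v) v) := by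
    rwa [← RCLike.re_ofReal_mul (K := ℂ)]
  exact pos_of_mul_pos_right h' (DyadicInterval.length_pos Q).le

theorem act_avg_act_inv (hW : IsMatrixWeight W) (Q : DyadicInterval)
    (v : EuclideanSpace ℂ (Fin d)) : act (avg Q W) (act (avg Q W)⁻¹ v) = v := by
  rw [← act_mul, Matrix.mul_nonsing_inv _ ((Matrix.isUnit_iff_isUnit_det _).1 (hW.isUnit_avg Q)),
    act_one]

/-- The matrix-weighted Carleson embedding theorem for scalar Carleson sequences. -/
theorem treeSum_le (hW : IsMatrixWeight W) {f : ℝ → EuclideanSpace ℂ (Fin d)}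
    (hf : MemLp f 2 rootMeasure) {w : ℝ → ℝ} (hwi : Integrable w rootMeasure)
    (hw0 : ∀ᵐ x ∂rootMeasure, 0 < w x)
    (hw : ∀ᵐ x ∂rootMeasure, ∀ v : EuclideanSpace ℂ (Fin d),
      w x * ‖v‖ ^ 2 ≤ RCLike.re (inner ℂ (act (W x) v) v))
    {α : DyadicInterval → ℝ} (hα : ∀ Q, 0 ≤ α Q)
    (hcar : ∀ Q : DyadicInterval, DyadicInterval.treeSum (fun R => ENNReal.ofReal (α R)) Q
      ≤ ENNReal.ofReal (∫ x in Q.toSet, w x))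
    (K : DyadicInterval) :
    DyadicInterval.treeSum (fun Q => ENNReal.ofReal (α Q *
        ‖act (avg Q W)⁻¹ (avg Q fun x => act (CFC.sqrt (W x)) (f x))‖ ^ 2)) K
      ≤ ENNReal.ofReal (4 * ∫ x in K.toSet, ‖f x‖ ^ 2) := by
  have hSf := hW.integrable_act_sqrt hf
  have hf2 : Integrable (fun x => ‖f x‖ ^ 2) rootMeasure := hf.norm.integrable_sq
  have hsymm : ∀ᵐ x ∂rootMeasure, star (W x) = W x := hW.posDef.mono fun x hx => hx.isHermitian
  refine DyadicInterval.treeSum_mul_sq_norm_le (𝕜 := ℂ) (φ := fun Q => ∫ x in Q.toSet, ‖f x‖ ^ 2)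
    (U := fun Q => (Matrix.toEuclideanCLM (n := Fin d) (𝕜 := ℂ) (∫ x in Q.toSet, W x) :
      EuclideanSpace ℂ (Fin d) →ₗ[ℂ] EuclideanSpace ℂ (Fin d)))
    (X := fun Q => ∫ x in Q.toSet, act (CFC.sqrt (W x)) (f x)) hα
    (fun Q => ne_top_of_le_ne_top ENNReal.ofReal_ne_top (hcar Q)) (fun Q => ?_)
    (fun Q => DyadicInterval.setIntegral_eq_add hSf Q)
    (fun Q => DyadicInterval.setIntegral_eq_add hf2 Q) (fun Q v u => ?_)
    (fun Q v hv => hW.re_inner_pos Q hv) (fun Q v => ?_) (fun Q v => ?_) (fun Q => ?_) K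
  · rw [DyadicInterval.setIntegral_eq_add hW.integrable Q, map_add]
    rfl
  · exact inner_act_setIntegral_symm (DyadicInterval.integrableOn_toSet hW.integrable Q)
      (DyadicInterval.ae_toSet hsymm Q) v u
  · refine le_trans ?_ (re_inner_act_setIntegral
      (DyadicInterval.integrableOn_toSet hW.integrable Q) v).ge
    calc _ ≤ (∫ x in Q.toSet, w x) * ‖v‖ ^ 2 := by
          gcongr
          exact ENNReal.toReal_le_of_le_ofReal (DyadicInterval.setIntegral_pos hwi hw0 Q).le
            (hcar Q)
      _ = ∫ x in Q.toSet, w x * ‖v‖ ^ 2 := by rw [integral_mul_const]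
      _ ≤ _ := by
          refine integral_mono_ae ((DyadicInterval.integrableOn_toSet hwi Q).mul_const _)
            (integrable_re_inner (integrable_act
              (DyadicInterval.integrableOn_toSet hW.integrable Q) v) v) ?_
          filter_upwards [DyadicInterval.ae_toSet hw Q] with x hx using hx v
  · have h1 : RCLike.re (inner ℂ (Matrix.toEuclideanCLM (n := Fin d) (𝕜 := ℂ)
        (∫ x in Q.toSet, W x) v) v) = ∫ x in Q.toSet, RCLike.re (inner ℂ (act (W x) v) v) :=
      re_inner_act_setIntegral (DyadicInterval.integrableOn_toSet hW.integrable Q) v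
    have hi1 := integrable_re_inner (DyadicInterval.integrableOn_toSet hSf Q) v
    have hi2 := integrable_re_inner (integrable_act
              (DyadicInterval.integrableOn_toSet hW.integrable Q) v) v
    rw [ContinuousLinearMap.coe_coe, h1,
      re_inner_setIntegral (DyadicInterval.integrableOn_toSet hSf Q), ← integral_const_mul,
      ← integral_sub (hi1.const_mul 2) hi2]
    refine integral_mono_ae ((hi1.const_mul 2).sub hi2)
      (DyadicInterval.integrableOn_toSet hf2 Q) ?_
    filter_upwards [DyadicInterval.ae_toSet hW.posDef Q] with x hx
    have h2 := re_inner_act_self hx.posSemidef v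
    -- Pointwise, the required inequality is `‖f - W^{1/2} v‖² ≥ 0`.
    have h3 := norm_sub_sq (𝕜 := ℂ) (f x) (act (CFC.sqrt (W x)) v)
    have h4 := sq_nonneg ‖f x - act (CFC.sqrt (W x)) v‖
    rw [inner_act_left, star_sqrt, h2]
    linarith
  · rw [DyadicInterval.setIntegral_eq_length_smul_avg,
      DyadicInterval.setIntegral_eq_length_smul_avg]
    exact (act_smul_real _ _ _).trans (by rw [hW.act_avg_act_inv])

end IsMatrixWeight

/-! ### The bilinear embedding under bounded conditioning. -/

instance : IsProbabilityMeasure rootMeasure := ⟨by simp [rootMeasure]⟩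

namespace DyadicInterval

/-- The root interval. -/
def root : DyadicInterval := ⟨0, 0⟩

theorem toSet_root : root.toSet = Set.Ico 0 1 := by
  simp [toSet, root]

theorem descendants_root : root.descendants = Set.univ :=
  Set.eq_univ_of_forall fun Q => by
    rw [descendants, Set.mem_ofPred_eq, toSet_root]
    exact toSet_subset_root Q

theorem treeSum_root (β : DyadicInterval → ℝ≥0∞) : treeSum β root = ∑' Q, β Q := by
  rw [treeSum, descendants_root, Set.indicator_univ]

theorem treeSum_ofReal_const_mul {c : ℝ} (hc : 0 ≤ c) (β : DyadicInterval → ℝ)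
    (K : DyadicInterval) : treeSum (fun Q => ENNReal.ofReal (c * β Q)) K
      = ENNReal.ofReal c * treeSum (fun Q => ENNReal.ofReal (β Q)) K := by
  rw [← treeSum_const_mul]
  simp only [ENNReal.ofReal_mul hc]

theorem root_setIntegral {F : Type*} [NormedAddCommGroup F] [NormedSpace ℝ F] (f : ℝ → F) :
    ∫ x in root.toSet, f x = ∫ x, f x ∂rootMeasure := by
  rw [toSet_root, rootMeasure]

end DyadicInterval

theorem tsum_sqrt_mul_sqrt_le {ι : Type*} (F G : ι → ℝ≥0∞) :
    ∑' i, F i ^ (1 / 2 : ℝ) * G i ^ (1 / 2 : ℝ)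
      ≤ (∑' i, F i) ^ (1 / 2 : ℝ) * (∑' i, G i) ^ (1 / 2 : ℝ) := by
  rw [ENNReal.tsum_eq_iSup_sum]
  refine iSup_le fun s => ?_
  refine (ENNReal.inner_le_Lp_mul_Lq s _ _ Real.HolderConjugate.two_two).trans ?_
  have h : ∀ x : ℝ≥0∞, (x ^ (1 / 2 : ℝ)) ^ (2 : ℝ) = x := fun x => by
    rw [← ENNReal.rpow_mul]
    norm_num
  simp only [h]
  gcongr <;> exact ENNReal.sum_le_tsum s

theorem eLpNorm_two_eq_ofReal_sqrt {f : ℝ → EuclideanSpace ℂ (Fin d)}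
    (hf : MemLp f 2 rootMeasure) :
    eLpNorm f 2 rootMeasure = ENNReal.ofReal (√(∫ x, ‖f x‖ ^ 2 ∂rootMeasure)) := by
  rw [hf.eLpNorm_eq_integral_rpow_norm two_ne_zero ENNReal.ofNat_ne_top, Real.sqrt_eq_rpow]
  simp

/-- The trace is additive, continuous and monotone, so it passes through the matrix Carleson bound;
the factor `d` is the trace of the identity and is how the dimension enters the estimate. -/
theorem IsCarleson.treeSum_trace_le {A : DyadicInterval → Matrix (Fin d) (Fin d) ℂ} {M : ℝ≥0}
    (hA : IsCarleson A M) (K : DyadicInterval) :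
    DyadicInterval.treeSum (fun Q => ENNReal.ofReal (A Q).trace.re) K
      ≤ ENNReal.ofReal (d * M * K.length) := by
  set T : Matrix (Fin d) (Fin d) ℂ →+ ℝ :=
    Complex.reAddGroupHom.comp (Matrix.traceAddMonoidHom (Fin d) ℂ) with hT
  have hTc : Continuous T := Complex.continuous_re.comp (Continuous.matrix_trace continuous_id)
  have hTa : ∀ B, T B = B.trace.re := fun B => rfl
  have hTs : ∀ (c : ℝ) B, T (c • B) = c * T B := by
    intro c B
    rw [hTa, hTa, Matrix.trace_smul, Complex.smul_re, smul_eq_mul]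
  have h1 := (hA.summable K).map T hTc
  have h2 := (hA.summable K).map_tsum T hTc
  have h3 : DyadicInterval.treeSum (fun Q => ENNReal.ofReal (A Q).trace.re) K
      = ENNReal.ofReal (∑' Q : K.descendants, T (A Q)) := by
    rw [ENNReal.ofReal_tsum_of_nonneg (f := fun Q : K.descendants => T (A Q))
        (fun Q => re_trace_nonneg (hA.posSemidef Q)) h1,
      DyadicInterval.treeSum, ← tsum_subtype]
    rfl
  rw [h3, ← h2]
  refine ENNReal.ofReal_le_ofReal ?_
  have h4 := re_trace_nonneg (Matrix.le_iff.1 (hA.sum_le K))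
  rw [← hTa, map_sub, hTs, hTs, hTa 1, Matrix.trace_one, Fintype.card_fin, Complex.natCast_re,
    sub_nonneg, inv_mul_le_iff₀ (DyadicInterval.length_pos K)] at h4
  linarith

namespace IsMatrixWeight

variable {W : ℝ → Matrix (Fin d) (Fin d) ℂ}

theorem ae_norm_mul_norm_inv_le {κ : ℝ≥0} (h : condC2 W ≤ κ) :
    ∀ᵐ x ∂rootMeasure, ‖W x‖ * ‖(W x)⁻¹‖ ≤ κ := by
  filter_upwards [ENNReal.ae_le_essSup fun x => ‖W x‖ₑ * ‖(W x)⁻¹‖ₑ] with x hx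
  have := hx.trans h
  simp only [enorm_eq_nnnorm] at this
  exact_mod_cast this

theorem ae_one_le [NeZero d] (hW : IsMatrixWeight W) :
    ∀ᵐ x ∂rootMeasure, 1 ≤ ‖W x‖ * ‖(W x)⁻¹‖ := by
  filter_upwards [hW.posDef] with x hx
  calc (1 : ℝ) = ‖(1 : Matrix (Fin d) (Fin d) ℂ)‖ := norm_one.symm
    _ = ‖W x * (W x)⁻¹‖ := by
      rw [Matrix.mul_nonsing_inv _ ((Matrix.isUnit_iff_isUnit_det _).1 hx.isUnit)]
    _ ≤ _ := norm_mul_le _ _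

/-- The bilinear embedding for a weight with bounded conditioning numbers. -/
theorem bilinearSum_le [NeZero d] (hW : IsMatrixWeight W) {κ : ℝ≥0} (hκ : condC2 W ≤ κ)
    {M : ℝ≥0} (hM : 0 < M) {A : DyadicInterval → Matrix (Fin d) (Fin d) ℂ} (hA : IsCarleson A M)
    {f g : ℝ → EuclideanSpace ℂ (Fin d)} (hf : MemLp f 2 rootMeasure)
    (hg : MemLp g 2 rootMeasure) :
    bilinearSum W A f g ≤ ENNReal.ofReal (16 * d * M * √κ * (√(∫ x, ‖f x‖ ^ 2 ∂rootMeasure) *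
      √(∫ x, ‖g x‖ ^ 2 ∂rootMeasure))) := by
  have hκle := ae_norm_mul_norm_inv_le hκ
  have hone := hW.ae_one_le
  have hκpos : (0 : ℝ) < κ := by
    obtain ⟨x, h1, h2⟩ := (hκle.and hone).exists
    linarith
  have hd : (0 : ℝ) < d := by exact_mod_cast Nat.pos_of_ne_zero (NeZero.ne d)
  set m : ℝ := d * M with hm
  have hmpos : 0 < m := mul_pos hd (by exact_mod_cast hM)
  set a : DyadicInterval → ℝ := fun Q => (A Q).trace.re with ha
  have ha0 : ∀ Q, 0 ≤ a Q := fun Q => re_trace_nonneg (hA.posSemidef Q)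
  have hcar := hA.treeSum_trace_le
  -- Almost everywhere `h ^ 2` is the smallest eigenvalue of `W`, and `h' ^ 2` its reciprocal.
  set h' : ℝ → ℝ := fun x => √‖(W x)⁻¹‖ with hh'
  set h : ℝ → ℝ := fun x => (√‖(W x)⁻¹‖)⁻¹ with hh
  have hinvpos : ∀ᵐ x ∂rootMeasure, 0 < ‖(W x)⁻¹‖ := hone.mono fun x hx =>
    pos_of_mul_pos_right (one_pos.trans_le hx) (norm_nonneg _)
  have hh'pos : ∀ᵐ x ∂rootMeasure, 0 < h' x := hinvpos.mono fun x hx => Real.sqrt_pos.2 hx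
  have hhpos : ∀ᵐ x ∂rootMeasure, 0 < h x := hh'pos.mono fun x hx => inv_pos.2 hx
  have hmul : ∀ᵐ x ∂rootMeasure, h x * h' x = 1 := hh'pos.mono fun x hx => inv_mul_cancel₀ hx.ne'
  have hmul' : ∀ᵐ x ∂rootMeasure, h' x * h x = 1 := hmul.mono fun x hx => by rw [mul_comm, hx]
  have hsq' : ∀ x, h' x ^ 2 = ‖(W x)⁻¹‖ := fun x => Real.sq_sqrt (norm_nonneg _)
  have hsq : ∀ x, h x ^ 2 = ‖(W x)⁻¹‖⁻¹ := fun x => by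
    simp only [hh]
    rw [inv_pow, Real.sq_sqrt (norm_nonneg _)]
  have hmeas' : AEStronglyMeasurable h' rootMeasure :=
    Real.continuous_sqrt.comp_aestronglyMeasurable hW.integrable_inv.aestronglyMeasurable.norm
  have hmeas : AEStronglyMeasurable h rootMeasure := hmeas'.aemeasurable.inv.aestronglyMeasurable
  have hint2' : Integrable (fun x => h' x ^ 2) rootMeasure := by
    simp only [hsq']
    exact hW.integrable_inv.norm
  have hint2 : Integrable (fun x => h x ^ 2) rootMeasure := by
    refine hW.integrable.norm.mono' (hmeas.pow 2) ?_
    filter_upwards [hone, hinvpos] with x h1 h2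
    rw [hsq, Real.norm_of_nonneg (by positivity), inv_le_iff_one_le_mul₀ h2]
    exact h1
  have hint' : Integrable h' rootMeasure :=
    ((memLp_two_iff_integrable_sq hmeas').2 hint2').integrable one_le_two
  have hint : Integrable h rootMeasure :=
    ((memLp_two_iff_integrable_sq hmeas).2 hint2).integrable one_le_two
  have hP := DyadicInterval.avg_pos hint hhpos
  have hR := DyadicInterval.avg_pos hint' hh'pos
  have t1 := DyadicInterval.treeSum_mul_avg_div_avg_le hmpos ha0 hcar hint hint' hint2 hhpos hmul
  have t2 := DyadicInterval.treeSum_mul_avg_div_avg_le hmpos ha0 hcar hint' hint hint2' hh'pos hmul'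
  -- The geometric mean of `ρ` and `σ` is `a`; `ρ` goes with `W` and `σ` with `W⁻¹`.
  set ρ : DyadicInterval → ℝ := fun Q => a Q * (avg Q h / avg Q h') with hρ
  set σ : DyadicInterval → ℝ := fun Q => a Q * (avg Q h' / avg Q h) with hσ
  have hρ0 : ∀ Q, 0 ≤ ρ Q := fun Q => mul_nonneg (ha0 Q) (div_nonneg (hP Q).le (hR Q).le)
  have hσ0 : ∀ Q, 0 ≤ σ Q := fun Q => mul_nonneg (ha0 Q) (div_nonneg (hR Q).le (hP Q).le)
  have hρσ : ∀ Q, ρ Q * σ Q = a Q ^ 2 := fun Q => by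
    have h1 := (hP Q).ne'
    have h2 := (hR Q).ne'
    simp only [hρ, hσ]
    field_simp
  have e1 := hW.treeSum_le hf hint2 (hhpos.mono fun x hx => by positivity)
    (by
      filter_upwards [hW.posDef, hinvpos] with x h1 h2 v
      rw [hsq, inv_mul_le_iff₀ h2]
      exact sq_norm_le_norm_inv_mul h1 v)
    (α := fun Q => (4 * m)⁻¹ * ρ Q) (fun Q => mul_nonneg (by positivity) (hρ0 Q))
    (fun Q => by
      rw [DyadicInterval.treeSum_ofReal_const_mul (by positivity)]
      refine (mul_le_mul_right (t1 Q) _).trans (le_of_eq ?_)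
      rw [← ENNReal.ofReal_mul (by positivity)]
      congr 1
      field_simp) DyadicInterval.root
  -- The smallest eigenvalue of `W⁻¹` is `‖W‖⁻¹`, at least `κ⁻¹ ‖W⁻¹‖`; this is the one place where
  -- the conditioning bound is lost as a factor.
  have e2 := hW.inv.treeSum_le hg (hint2'.const_mul (κ : ℝ)⁻¹)
    (hh'pos.mono fun x hx => by positivity)
    (by
      filter_upwards [hW.posDef, hinvpos, hκle] with x h1 h2 h3 v
      rw [hsq', mul_assoc, inv_mul_le_iff₀ hκpos]
      have h4 := sq_norm_le_norm_inv_mul h1.inv v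
      rw [inv_inv_of_posDef h1] at h4
      have h5 : 0 ≤ RCLike.re (inner ℂ (act (W x)⁻¹ v) v) := by
        rw [re_inner_act_self h1.inv.posSemidef]
        positivity
      calc _ ≤ ‖(W x)⁻¹‖ * (‖W x‖ * RCLike.re (inner ℂ (act (W x)⁻¹ v) v)) :=
            mul_le_mul_of_nonneg_left h4 h2.le
        _ = (‖W x‖ * ‖(W x)⁻¹‖) * RCLike.re (inner ℂ (act (W x)⁻¹ v) v) := by ring
        _ ≤ _ := mul_le_mul_of_nonneg_right h3 h5)
    (α := fun Q => (4 * m * κ)⁻¹ * σ Q) (fun Q => mul_nonneg (by positivity) (hσ0 Q))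
    (fun Q => by
      rw [DyadicInterval.treeSum_ofReal_const_mul (by positivity), integral_const_mul]
      refine (mul_le_mul_right (t2 Q) _).trans (le_of_eq ?_)
      rw [← ENNReal.ofReal_mul (by positivity)]
      congr 1
      field_simp) DyadicInterval.root
  simp only [mul_assoc] at e1 e2
  rw [DyadicInterval.treeSum_ofReal_const_mul (by positivity), DyadicInterval.treeSum_root,
    DyadicInterval.root_setIntegral] at e1 e2
  set X : DyadicInterval → ℝ := fun Q =>
    ‖act (avg Q W)⁻¹ (avg Q fun x => act (CFC.sqrt (W x)) (f x))‖ with hX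
  set Y : DyadicInterval → ℝ := fun Q =>
    ‖act (avg Q fun x => (W x)⁻¹)⁻¹ (avg Q fun x => act (CFC.sqrt (W x)⁻¹) (g x))‖ with hY
  have cancel : ∀ (c : ℝ) (S : ℝ≥0∞) (I : ℝ), 0 < c →
      ENNReal.ofReal c⁻¹ * S ≤ ENNReal.ofReal I → S ≤ ENNReal.ofReal (c * I) := by
    intro c S I hc hS
    rw [ENNReal.ofReal_mul hc.le, ← ENNReal.inv_mul_le_iff, ← ENNReal.ofReal_inv_of_pos hc]
    · exact hS
    · exact (ENNReal.ofReal_pos.2 hc).ne'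
    · exact ENNReal.ofReal_ne_top
  have e1' := cancel _ _ _ (by positivity) e1
  have e2' := cancel _ _ _ (by positivity) e2
  have hterm : ∀ Q, ‖act (CFC.sqrt (A Q)) (act (avg Q W)⁻¹
        (avg Q fun x => act (CFC.sqrt (W x)) (f x)))‖ₑ *
      ‖act (CFC.sqrt (A Q)) (act (avg Q fun x => (W x)⁻¹)⁻¹
        (avg Q fun x => act (CFC.sqrt (W x)⁻¹) (g x)))‖ₑ
      ≤ ENNReal.ofReal (ρ Q * X Q ^ 2) ^ (1 / 2 : ℝ) *
        ENNReal.ofReal (σ Q * Y Q ^ 2) ^ (1 / 2 : ℝ) := by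
    intro Q
    have b1 := norm_act_sqrt_sq_le_trace (hA.posSemidef Q) (act (avg Q W)⁻¹
        (avg Q fun x => act (CFC.sqrt (W x)) (f x)))
    have b2 := norm_act_sqrt_sq_le_trace (hA.posSemidef Q) (act (avg Q fun x => (W x)⁻¹)⁻¹
        (avg Q fun x => act (CFC.sqrt (W x)⁻¹) (g x)))
    rw [← ofReal_norm, ← ofReal_norm, ← ENNReal.ofReal_mul (norm_nonneg _),
      ← ENNReal.mul_rpow_of_nonneg _ _ (by norm_num),
      ← ENNReal.ofReal_mul (mul_nonneg (hρ0 Q) (sq_nonneg _)),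
      ENNReal.ofReal_rpow_of_nonneg (mul_nonneg (mul_nonneg (hρ0 Q) (sq_nonneg _))
        (mul_nonneg (hσ0 Q) (sq_nonneg _))) (by norm_num), ← Real.sqrt_eq_rpow]
    refine ENNReal.ofReal_le_ofReal (Real.le_sqrt_of_sq_le ?_)
    rw [mul_pow, mul_mul_mul_comm, hρσ]
    calc _ ≤ (a Q * X Q ^ 2) * (a Q * Y Q ^ 2) :=
          mul_le_mul b1 b2 (sq_nonneg _) (mul_nonneg (ha0 Q) (sq_nonneg _))
      _ = _ := by ring
  refine (ENNReal.tsum_le_tsum hterm).trans ((tsum_sqrt_mul_sqrt_le _ _).trans ?_)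
  set F2 := ∫ x, ‖f x‖ ^ 2 ∂rootMeasure
  set G2 := ∫ x, ‖g x‖ ^ 2 ∂rootMeasure
  have hF2 : 0 ≤ F2 := integral_nonneg fun x => sq_nonneg _
  have hG2 : 0 ≤ G2 := integral_nonneg fun x => sq_nonneg _
  calc _ ≤ ENNReal.ofReal (4 * m * (4 * F2)) ^ (1 / 2 : ℝ) *
        ENNReal.ofReal (4 * (m * κ) * (4 * G2)) ^ (1 / 2 : ℝ) := by
        gcongr
    _ = ENNReal.ofReal (√((4 * m * (4 * F2)) * (4 * (m * κ) * (4 * G2)))) := by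
        rw [← ENNReal.mul_rpow_of_nonneg _ _ (by norm_num), ← ENNReal.ofReal_mul (by positivity),
          ENNReal.ofReal_rpow_of_nonneg (by positivity) (by norm_num), ← Real.sqrt_eq_rpow]
    _ = _ := by
        congr 1
        rw [show (4 * m * (4 * F2)) * (4 * (m * κ) * (4 * G2)) = (16 * m) ^ 2 * (κ * (F2 * G2)) by
          ring, Real.sqrt_mul (sq_nonneg _), Real.sqrt_sq (by positivity),
          Real.sqrt_mul hκpos.le, Real.sqrt_mul hF2, hm]
        ring

end IsMatrixWeight

theorem avg_eq_zero_of_ae {F : Type*} [NormedAddCommGroup F] [NormedSpace ℝ F] {f : ℝ → F}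
    (h : ∀ᵐ x ∂rootMeasure, f x = 0) (Q : DyadicInterval) : avg Q f = 0 := by
  rw [DyadicInterval.avg_eq_smul, integral_eq_zero_of_ae (DyadicInterval.ae_toSet h Q), smul_zero]

theorem act_zero_right (M : Matrix (Fin d) (Fin d) ℂ) : act M 0 = 0 := by
  simp [act]

theorem ae_eq_zero_of_eLpNorm {f : ℝ → EuclideanSpace ℂ (Fin d)} (hf : MemLp f 2 rootMeasure)
    (h : eLpNorm f 2 rootMeasure = 0) : ∀ᵐ x ∂rootMeasure, f x = 0 :=
  (eLpNorm_eq_zero_iff hf.aestronglyMeasurable two_ne_zero).1 h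

/-- The bilinear embedding, with a constant linear in the dimension. -/
theorem bilinearEmbedding_of_isMatrixWeight {W : ℝ → Matrix (Fin d) (Fin d) ℂ}
    (hW : IsMatrixWeight W) (M : ℝ≥0) :
    BilinearEmbedding W M (((16 * (d + 1) : ℝ≥0) : ℝ≥0∞) * (M : ℝ≥0∞) *
      condC2 W ^ (1 / 2 : ℝ)) := by
  intro A hA f g hf hg
  have hzero : ∀ {S : ℝ≥0∞}, bilinearSum W A f g = 0 → bilinearSum W A f g ≤ S :=
    fun h => h ▸ zero_le
  rcases eq_or_ne d 0 with rfl | hd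
  · refine hzero (ENNReal.tsum_eq_zero.2 fun Q => ?_)
    rw [Subsingleton.elim (act (CFC.sqrt (A Q)) _) 0]
    simp
  have : NeZero d := ⟨hd⟩
  -- The cases of zero `M`, `f` or `g` are separated because `0 * ∞ = 0`: an infinite `condC2 W`
  -- would not make the bound trivial there.
  rcases eq_or_ne M 0 with rfl | hM
  · refine hzero (ENNReal.tsum_eq_zero.2 fun Q => ?_)
    have h1 := hA.treeSum_trace_le Q
    rw [DyadicInterval.treeSum_eq_add_children] at h1
    have h2 : (A Q).trace.re ≤ 0 := by
      have := le_self_add.trans h1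
      simpa using this
    have h3 := norm_act_sqrt_sq_le_trace (hA.posSemidef Q)
      (act (avg Q W)⁻¹ (avg Q fun x => act (CFC.sqrt (W x)) (f x)))
    have h4 := h3.trans (mul_nonpos_of_nonpos_of_nonneg h2 (sq_nonneg _))
    have h5 := pow_eq_zero_iff (two_ne_zero) |>.1 (le_antisymm h4 (sq_nonneg _))
    rw [norm_eq_zero] at h5
    rw [h5]
    simp
  rcases eq_or_ne (eLpNorm f 2 rootMeasure) 0 with hf0 | hf0
  · refine hzero (ENNReal.tsum_eq_zero.2 fun Q => ?_)
    rw [avg_eq_zero_of_ae (f := fun x => act (CFC.sqrt (W x)) (f x))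
      ((ae_eq_zero_of_eLpNorm hf hf0).mono fun x hx => by
      rw [hx, act_zero_right]), act_zero_right, act_zero_right]
    simp
  rcases eq_or_ne (eLpNorm g 2 rootMeasure) 0 with hg0 | hg0
  · refine hzero (ENNReal.tsum_eq_zero.2 fun Q => ?_)
    rw [avg_eq_zero_of_ae (f := fun x => act (CFC.sqrt (W x)⁻¹) (g x))
      ((ae_eq_zero_of_eLpNorm hg hg0).mono fun x hx => by
      rw [hx, act_zero_right]), act_zero_right, act_zero_right]
    simp
  have hC : ((16 * (d + 1) : ℝ≥0) : ℝ≥0∞) * (M : ℝ≥0∞) ≠ 0 :=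
    mul_ne_zero (ENNReal.coe_ne_zero.2 (by positivity)) (ENNReal.coe_ne_zero.2 hM)
  rcases eq_or_ne (condC2 W) ∞ with hκ | hκ
  · rw [hκ, ENNReal.top_rpow_of_pos (by norm_num), ENNReal.mul_top hC, ENNReal.top_mul hf0,
      ENNReal.top_mul hg0]
    exact le_top
  · lift condC2 W to ℝ≥0 using hκ with κ hκ'
    refine (hW.bilinearSum_le hκ'.ge (pos_of_ne_zero hM) hA hf hg).trans ?_
    rw [eLpNorm_two_eq_ofReal_sqrt hf, eLpNorm_two_eq_ofReal_sqrt hg, mul_assoc _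
      (ENNReal.ofReal _) (ENNReal.ofReal _), ← ENNReal.ofReal_mul (Real.sqrt_nonneg _),
      ENNReal.ofReal_mul (by positivity)]
    gcongr
    rw [← ENNReal.ofReal_coe_nnreal (p := κ), ← ENNReal.ofReal_coe_nnreal (p := M),
      ← ENNReal.ofReal_coe_nnreal (p := 16 * (d + 1)),
      ENNReal.ofReal_rpow_of_nonneg κ.coe_nonneg (by norm_num), ← Real.sqrt_eq_rpow,
      ← ENNReal.ofReal_mul (by positivity), ← ENNReal.ofReal_mul (by positivity)]
    refine ENNReal.ofReal_le_ofReal ?_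
    push_cast
    gcongr
    linarith

/-! ### Necessity: dyadic differentiation and testing on one interval. -/

namespace DyadicInterval

/-- The dyadic interval of a given level that contains a given point of the root interval. -/
def containing (x : ℝ) (n : ℕ) : DyadicInterval :=
  -- The remainder only supplies a legal index for `x` outside `[0, 1)`; inside it changes nothing.
  ⟨n, ⟨⌊x * 2 ^ n⌋₊ % 2 ^ n, Nat.mod_lt _ (by positivity)⟩⟩

theorem mem_containing {x : ℝ} (hx : x ∈ Set.Ico (0 : ℝ) 1) (n : ℕ) :
    x ∈ (containing x n).toSet := by
  have hp : (0 : ℝ) < 2 ^ n := by positivity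
  have h0 : 0 ≤ x * 2 ^ n := mul_nonneg hx.1 hp.le
  have hlt : ⌊x * 2 ^ n⌋₊ < 2 ^ n := by
    rw [Nat.floor_lt h0]
    push_cast
    nlinarith [hx.2]
  simp only [toSet, containing, Nat.mod_eq_of_lt hlt, Set.mem_Ico]
  rw [div_le_iff₀ hp, lt_div_iff₀ hp]
  exact ⟨Nat.floor_le h0, Nat.lt_floor_add_one _⟩

/-- The differentiation theorem averages over closed balls; the two sets differ by an endpoint only.
-/
theorem closedBall_ae_eq_toSet (Q : DyadicInterval) :
    Metric.closedBall (((Q.index : ℕ) : ℝ) / 2 ^ Q.level + 1 / 2 / 2 ^ Q.level)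
      (1 / 2 / 2 ^ Q.level) =ᵐ[volume] Q.toSet := by
  rw [Real.closedBall_eq_Icc, toSet]
  have e : ((Q.index : ℕ) : ℝ) / 2 ^ Q.level + 1 / 2 / 2 ^ Q.level + 1 / 2 / 2 ^ Q.level
      = (((Q.index : ℕ) : ℝ) + 1) / 2 ^ Q.level := by ring
  rw [e, add_sub_cancel_right]
  exact Ico_ae_eq_Icc.symm

/-- Lebesgue differentiation along dyadic intervals. -/
theorem ae_tendsto_avg_containing {F : Type*} [NormedAddCommGroup F] [NormedSpace ℝ F]
    [CompleteSpace F] {f : ℝ → F} (hf : Integrable f rootMeasure) :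
    ∀ᵐ x ∂rootMeasure, Filter.Tendsto (fun n => avg (containing x n) f) Filter.atTop
      (nhds (f x)) := by
  have hg : Integrable ((Set.Ico (0 : ℝ) 1).indicator f) volume :=
    (integrable_indicator_iff measurableSet_Ico).2 hf
  have h := IsUnifLocDoublingMeasure.ae_tendsto_average volume hg.locallyIntegrable 1
  rw [rootMeasure, ae_restrict_iff' measurableSet_Ico]
  filter_upwards [h] with x hx hx01
  have hδ : Filter.Tendsto (fun n : ℕ => (1 : ℝ) / 2 / 2 ^ n) Filter.atTop
      (nhdsWithin 0 (Set.Ioi 0)) := by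
    refine tendsto_nhdsWithin_iff.2 ⟨?_, Filter.Eventually.of_forall fun n => ?_⟩
    · have := (tendsto_pow_atTop_nhds_zero_of_lt_one (r := (1 / 2 : ℝ)) (by norm_num)
        (by norm_num)).const_mul (1 / 2)
      simpa [div_eq_mul_inv] using this
    · exact Set.mem_Ioi.2 (by positivity)
  -- The balls are centred at the midpoints of the intervals, not at `x`; it suffices that they
  -- contain `x`.
  have h1 := hx (fun n => (((containing x n).index : ℕ) : ℝ) / 2 ^ n + 1 / 2 / 2 ^ n)
    (fun n => 1 / 2 / 2 ^ n) hδ (Filter.Eventually.of_forall fun n => by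
      have h2 := mem_containing hx01 n
      simp only [toSet, containing, Set.mem_Ico] at h2
      rw [one_mul, Real.closedBall_eq_Icc, Set.mem_Icc]
      refine ⟨?_, ?_⟩
      · rw [add_sub_cancel_right]
        exact h2.1
      · refine h2.2.le.trans (le_of_eq ?_)
        simp only [containing]
        ring)
  rw [Set.indicator_of_mem hx01] at h1
  refine h1.congr fun n => ?_
  rw [avg]
  have e := closedBall_ae_eq_toSet (containing x n)
  refine (setAverage_congr e).trans (setAverage_congr_fun (measurableSet_toSet _) ?_)
  exact ae_of_all _ fun y hy => Set.indicator_of_mem (toSet_subset_root _ hy) f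

theorem length_le_of_mem_descendants {Q K : DyadicInterval} (h : Q ∈ K.descendants) :
    Q.length ≤ K.length := by
  simp only [length]
  gcongr
  · norm_num
  · exact level_le_of_mem_descendants h

end DyadicInterval

/-- The only nontrivial constraint comes from `K ⊇ Q` and reads `|Q| / |K| ≤ 1`. -/
theorem isCarleson_indicator (Q : DyadicInterval) :
    IsCarleson (({Q} : Set DyadicInterval).indicator
      fun _ => Q.length • (1 : Matrix (Fin d) (Fin d) ℂ)) 1 := by
  have hpsd : (Q.length • (1 : Matrix (Fin d) (Fin d) ℂ)).PosSemidef :=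
    Matrix.PosSemidef.one.smul (DyadicInterval.length_pos Q).le
  refine ⟨fun R => ?_, fun K => ?_, fun K => ?_⟩
  · by_cases h : R = Q
    · rw [Set.indicator_of_mem (Set.mem_singleton_iff.2 h)]
      exact hpsd
    · rw [Set.indicator_of_notMem (by simpa using h)]
      exact Matrix.PosSemidef.zero
  · refine summable_of_hasFiniteSupport (Set.Subsingleton.finite fun R hR S hS => ?_)
    have h1 : (R : DyadicInterval) ∈ ({Q} : Set DyadicInterval) :=
      Set.mem_of_indicator_ne_zero hR
    have h2 : (S : DyadicInterval) ∈ ({Q} : Set DyadicInterval) :=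
      Set.mem_of_indicator_ne_zero hS
    exact Subtype.ext (h1.trans h2.symm)
  · rw [tsum_subtype K.descendants (({Q} : Set DyadicInterval).indicator
      fun _ => Q.length • (1 : Matrix (Fin d) (Fin d) ℂ)), tsum_eq_single Q fun R hR => by
        rw [Set.indicator_indicator, Set.indicator_of_notMem]
        exact fun h => hR h.2]
    rw [Matrix.le_iff]
    by_cases h : Q ∈ K.descendants
    · rw [Set.indicator_of_mem h, Set.indicator_of_mem (Set.mem_singleton Q), smul_smul, ← sub_smul]
      refine Matrix.PosSemidef.one.smul ?_
      rw [NNReal.coe_one, sub_nonneg, inv_mul_le_iff₀ (DyadicInterval.length_pos K), mul_one]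
      exact DyadicInterval.length_le_of_mem_descendants h
    · rw [Set.indicator_of_notMem h, smul_zero, sub_zero]
      exact Matrix.PosSemidef.one.smul zero_le_one

theorem norm_act_sqrt_smul_one {c : ℝ} (hc : 0 ≤ c) (v : EuclideanSpace ℂ (Fin d)) :
    ‖act (CFC.sqrt (c • (1 : Matrix (Fin d) (Fin d) ℂ))) v‖ = √c * ‖v‖ := by
  have h := re_inner_act_self (Matrix.PosSemidef.one.smul hc :
    (c • (1 : Matrix (Fin d) (Fin d) ℂ)).PosSemidef) v
  rw [act_smul_real, act_one, ← Complex.coe_smul, inner_smul_left, Complex.conj_ofReal] at h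
  have h1 : RCLike.re ((c : ℂ) * inner ℂ v v) = c * ‖v‖ ^ 2 := by
    rw [← inner_self_eq_norm_sq (𝕜 := ℂ)]
    exact RCLike.re_ofReal_mul (K := ℂ) c _
  rw [h1] at h
  rw [← Real.sqrt_sq (norm_nonneg (act _ v)), ← h, Real.sqrt_mul hc, Real.sqrt_sq (norm_nonneg _)]

namespace IsMatrixWeight

variable {W : ℝ → Matrix (Fin d) (Fin d) ℂ}

theorem memLp_indicator (hW : IsMatrixWeight W) (Q : DyadicInterval)
    (e : EuclideanSpace ℂ (Fin d)) :
    MemLp (Q.toSet.indicator fun x => act (CFC.sqrt (W x)) e) 2 rootMeasure := by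
  refine MemLp.indicator (DyadicInterval.measurableSet_toSet Q) ?_
  refine MemLp.of_le_mul (c := ‖e‖) hW.memLp_sqrt
    (aestronglyMeasurable_act hW.aestronglyMeasurable_sqrt aestronglyMeasurable_const)
    (ae_of_all _ fun x => ?_)
  rw [mul_comm]
  exact norm_act_le _ _

/-- The test function is chosen so that `⟨W⟩_Q⁻¹` in the bilinear sum cancels and leaves `e` itself.
-/
theorem avg_indicator (hW : IsMatrixWeight W) (Q : DyadicInterval)
    (e : EuclideanSpace ℂ (Fin d)) :
    avg Q (fun x => act (CFC.sqrt (W x)) (Q.toSet.indicator (fun x => act (CFC.sqrt (W x)) e) x))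
      = act (avg Q W) e := by
  rw [DyadicInterval.avg_eq_smul, DyadicInterval.avg_eq_smul, act_smul_real,
    act_setIntegral (DyadicInterval.integrableOn_toSet hW.integrable Q)]
  congr 1
  refine integral_congr_ae ?_
  filter_upwards [DyadicInterval.ae_toSet hW.posDef Q,
    ae_restrict_mem (DyadicInterval.measurableSet_toSet Q)] with x h1 h2
  rw [Set.indicator_of_mem h2, ← act_mul, sqrt_mul_sqrt h1.posSemidef]

theorem eLpNorm_indicator (hW : IsMatrixWeight W) (Q : DyadicInterval)
    (e : EuclideanSpace ℂ (Fin d)) :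
    eLpNorm (Q.toSet.indicator fun x => act (CFC.sqrt (W x)) e) 2 rootMeasure
      = ENNReal.ofReal (√(Q.length * RCLike.re (inner ℂ (act (avg Q W) e) e))) := by
  rw [eLpNorm_two_eq_ofReal_sqrt (hW.memLp_indicator Q e)]
  congr 2
  have h1 : ∀ x, ‖Q.toSet.indicator (fun x => act (CFC.sqrt (W x)) e) x‖ ^ 2
      = Q.toSet.indicator (fun x => ‖act (CFC.sqrt (W x)) e‖ ^ 2) x := by
    intro x
    by_cases hx : x ∈ Q.toSet <;> simp [hx]
  simp only [h1]
  rw [integral_indicator (DyadicInterval.measurableSet_toSet Q), rootMeasure,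
    Measure.restrict_restrict (DyadicInterval.measurableSet_toSet Q),
    Set.inter_eq_left.2 (DyadicInterval.toSet_subset_root Q)]
  have h2 : ∫ x in Q.toSet, ‖act (CFC.sqrt (W x)) e‖ ^ 2
      = RCLike.re (inner ℂ (act (∫ x in Q.toSet, W x) e) e) := by
    rw [re_inner_act_setIntegral (DyadicInterval.integrableOn_toSet hW.integrable Q)]
    refine integral_congr_ae ((DyadicInterval.ae_toSet hW.posDef Q).mono fun x hx => ?_)
    exact (re_inner_act_self hx.posSemidef e).symm
  rw [h2, DyadicInterval.setIntegral_eq_length_smul_avg, act_smul_real, ← Complex.coe_smul,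
    inner_smul_left, Complex.conj_ofReal]
  exact RCLike.re_ofReal_mul (K := ℂ) _ _

theorem act_inv_act_avg (hW : IsMatrixWeight W) (Q : DyadicInterval)
    (v : EuclideanSpace ℂ (Fin d)) : act (avg Q W)⁻¹ (act (avg Q W) v) = v := by
  rw [← act_mul, Matrix.nonsing_inv_mul _ ((Matrix.isUnit_iff_isUnit_det _).1 (hW.isUnit_avg Q)),
    act_one]

/-- Testing the bilinear embedding on a Carleson sequence with a single term. -/
theorem norm_mul_norm_le_of_bilinearEmbedding (hW : IsMatrixWeight W) {C : ℝ≥0}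
    (h : BilinearEmbedding W 1 C) (Q : DyadicInterval) (e e' : EuclideanSpace ℂ (Fin d)) :
    ‖e‖ * ‖e'‖ ≤ C * (√(RCLike.re (inner ℂ (act (avg Q W) e) e)) *
      √(RCLike.re (inner ℂ (act (avg Q fun x => (W x)⁻¹) e') e'))) := by
  have h1 := h _ (isCarleson_indicator Q) _ _ (hW.memLp_indicator Q e)
    (hW.inv.memLp_indicator Q e')
  have h2 := (ENNReal.le_tsum Q).trans h1
  rw [Set.indicator_of_mem (Set.mem_singleton Q), hW.avg_indicator, hW.inv.avg_indicator,
    hW.act_inv_act_avg, hW.inv.act_inv_act_avg, hW.eLpNorm_indicator, hW.inv.eLpNorm_indicator,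
    ← ofReal_norm, ← ofReal_norm] at h2
  have hl := DyadicInterval.length_pos Q
  rw [norm_act_sqrt_smul_one hl.le, norm_act_sqrt_smul_one hl.le,
    ← ENNReal.ofReal_mul (by positivity), ← ENNReal.ofReal_coe_nnreal,
    ← ENNReal.ofReal_mul (by positivity), ← ENNReal.ofReal_mul (by positivity),
    ENNReal.ofReal_le_ofReal_iff (by positivity), Real.sqrt_mul hl.le, Real.sqrt_mul hl.le] at h2
  have hs : √Q.length * √Q.length = Q.length := Real.mul_self_sqrt hl.le
  refine le_of_mul_le_mul_left ?_ hl
  calc _ = √Q.length * ‖e‖ * (√Q.length * ‖e'‖) := by rw [mul_mul_mul_comm, hs]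
    _ ≤ _ := h2
    _ = (√Q.length * √Q.length) * (C * (√(RCLike.re (inner ℂ (act (avg Q W) e) e)) *
      √(RCLike.re (inner ℂ (act (avg Q fun x => (W x)⁻¹) e') e')))) := by ring
    _ = _ := by rw [hs]

end IsMatrixWeight

theorem continuous_re_inner_act (e : EuclideanSpace ℂ (Fin d)) :
    Continuous fun M : Matrix (Fin d) (Fin d) ℂ => RCLike.re (inner ℂ (act M e) e) :=
  RCLike.continuous_re.comp (((actVec e).continuous).inner continuous_const)

theorem norm_mul_le_of_forall {M : Matrix (Fin d) (Fin d) ℂ} {c D : ℝ} (hc : 0 ≤ c) (hD : 0 ≤ D)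
    (h : ∀ u, ‖act M u‖ * c ≤ D * ‖u‖) : ‖M‖ * c ≤ D := by
  rcases hc.eq_or_lt with rfl | hc
  · rwa [mul_zero]
  rw [← le_div_iff₀ hc, ← Matrix.l2_opNorm_toEuclideanCLM]
  refine ContinuousLinearMap.opNorm_le_bound _ (by positivity) fun u => ?_
  rw [div_mul_eq_mul_div, le_div_iff₀ hc]
  exact h u

namespace IsMatrixWeight

variable {W : ℝ → Matrix (Fin d) (Fin d) ℂ}

/-- The bilinear embedding bounds the conditioning numbers of the weight. -/
theorem ae_le_of_bilinearEmbedding (hW : IsMatrixWeight W) {C : ℝ≥0}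
    (h : BilinearEmbedding W 1 C) : ∀ᵐ x ∂rootMeasure, ‖W x‖ * ‖(W x)⁻¹‖ ≤ (C : ℝ) ^ 2 := by
  filter_upwards [hW.posDef, DyadicInterval.ae_tendsto_avg_containing hW.integrable,
    DyadicInterval.ae_tendsto_avg_containing hW.integrable_inv] with x hx h1 h2
  have key : ∀ e e' : EuclideanSpace ℂ (Fin d), ‖e‖ * ‖e'‖ ≤
      C * (‖act (CFC.sqrt (W x)) e‖ * ‖act (CFC.sqrt (W x)⁻¹) e'‖) := by
    intro e e'
    have l1 := ((continuous_re_inner_act e).tendsto _).comp h1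
    have l2 := ((continuous_re_inner_act e').tendsto _).comp h2
    have l3 := (((Real.continuous_sqrt.tendsto _).comp l1).mul
      ((Real.continuous_sqrt.tendsto _).comp l2)).const_mul (C : ℝ)
    have l4 := ge_of_tendsto' l3 fun n =>
      hW.norm_mul_norm_le_of_bilinearEmbedding h (DyadicInterval.containing x n) e e'
    rwa [re_inner_act_self hx.posSemidef, re_inner_act_self hx.inv.posSemidef,
      Real.sqrt_sq (norm_nonneg _), Real.sqrt_sq (norm_nonneg _)] at l4
  have key2 : ‖CFC.sqrt (W x)‖ * ‖CFC.sqrt (W x)⁻¹‖ ≤ C := by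
    refine norm_mul_le_of_forall (norm_nonneg _) C.coe_nonneg fun u => ?_
    rw [mul_comm]
    refine norm_mul_le_of_forall (norm_nonneg _) (by positivity) fun u' => ?_
    -- The roots are put on the test vectors, so that they cancel on the right and both operator
    -- norms appear on the left.
    have := key (act (CFC.sqrt (W x)⁻¹) u') (act (CFC.sqrt (W x)) u)
    rw [← act_mul, ← act_mul, sqrt_mul_sqrt_inv hx, sqrt_inv_mul_sqrt hx, act_one, act_one] at this
    calc _ ≤ _ := this
      _ = _ := by ring
  rw [← norm_sqrt_sq hx.posSemidef, ← norm_sqrt_sq hx.inv.posSemidef, ← mul_pow]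
  exact pow_le_pow_left₀ (by positivity) key2 2

theorem condC2_le_of_bilinearEmbedding (hW : IsMatrixWeight W) {C : ℝ≥0}
    (h : BilinearEmbedding W 1 C) : condC2 W ^ (1 / 2 : ℝ) ≤ C := by
  have h1 : condC2 W ≤ (C : ℝ≥0∞) ^ (2 : ℝ) := by
    refine essSup_le_of_ae_le _ ((hW.ae_le_of_bilinearEmbedding h).mono fun x hx => ?_)
    simp only [enorm_eq_nnnorm]
    rw [ENNReal.rpow_ofNat]
    exact_mod_cast hx
  calc _ ≤ ((C : ℝ≥0∞) ^ (2 : ℝ)) ^ (1 / 2 : ℝ) := by gcongr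
    _ = _ := by
      rw [← ENNReal.rpow_mul]
      norm_num

end IsMatrixWeight

/-! ### Diagonal weights and the constant counterexamples. -/

/-- The diagonal matrix with given real entries. -/
def realDiagonal (r : Fin d → ℝ) : Matrix (Fin d) (Fin d) ℂ :=
  Matrix.diagonal fun i => (r i : ℂ)

theorem realDiagonal_eq_sum (r : Fin d → ℝ) :
    realDiagonal r = ∑ i, r i • realDiagonal (Pi.single i 1) := by
  ext j k
  rw [Matrix.sum_apply]
  by_cases h : j = k
  · subst h
    simp [realDiagonal, Pi.single_apply, apply_ite Complex.ofReal]
  · simp [realDiagonal, h]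

theorem realDiagonal_mul (r s : Fin d → ℝ) :
    realDiagonal r * realDiagonal s = realDiagonal fun i => r i * s i := by
  simp [realDiagonal, Matrix.diagonal_mul_diagonal]

theorem realDiagonal_one : realDiagonal (fun _ : Fin d => 1) = 1 := by
  simp [realDiagonal]

theorem inv_realDiagonal {r : Fin d → ℝ} (h : ∀ i, r i ≠ 0) :
    (realDiagonal r)⁻¹ = realDiagonal fun i => (r i)⁻¹ := by
  refine Matrix.inv_eq_right_inv ?_
  rw [realDiagonal_mul, ← realDiagonal_one]
  congr 1
  ext i
  exact mul_inv_cancel₀ (h i)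

theorem posDef_realDiagonal {r : Fin d → ℝ} (h : ∀ i, 0 < r i) : (realDiagonal r).PosDef :=
  Matrix.PosDef.diagonal fun i => by
    rw [Complex.zero_lt_real]
    exact h i

theorem posSemidef_realDiagonal {r : Fin d → ℝ} (h : ∀ i, 0 ≤ r i) :
    (realDiagonal r).PosSemidef :=
  Matrix.PosSemidef.diagonal fun i => by
    simpa using h i

theorem sqrt_realDiagonal {r : Fin d → ℝ} (h : ∀ i, 0 ≤ r i) :
    CFC.sqrt (realDiagonal r) = realDiagonal fun i => √(r i) := by
  refine CFC.sqrt_unique ?_ (Matrix.nonneg_iff_posSemidef.2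
    (posSemidef_realDiagonal fun i => Real.sqrt_nonneg _))
  rw [realDiagonal_mul]
  congr 1
  ext i
  exact Real.mul_self_sqrt (h i)

theorem norm_realDiagonal_le {r : Fin d → ℝ} {B : ℝ} (hB : 0 ≤ B) (h : ∀ i, |r i| ≤ B) :
    ‖realDiagonal r‖ ≤ B := by
  rw [realDiagonal, Matrix.l2_opNorm_diagonal, pi_norm_le_iff_of_nonneg hB]
  intro i
  rw [Complex.norm_real]
  exact h i

theorem abs_le_norm_realDiagonal (r : Fin d → ℝ) (i : Fin d) : |r i| ≤ ‖realDiagonal r‖ := by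
  rw [realDiagonal, Matrix.l2_opNorm_diagonal]
  have := norm_le_pi_norm (fun i => (r i : ℂ)) i
  rwa [Complex.norm_real] at this

theorem integrable_realDiagonal {v : ℝ → Fin d → ℝ} {μ : Measure ℝ}
    (h : ∀ i, Integrable (fun x => v x i) μ) : Integrable (fun x => realDiagonal (v x)) μ := by
  have h1 : (fun x => realDiagonal (v x))
      = fun x => ∑ i, v x i • realDiagonal (Pi.single i 1) := by
    ext1 x
    exact realDiagonal_eq_sum _
  rw [h1]
  exact integrable_finsetSum _ fun i _ => (h i).smul_const _

theorem avg_realDiagonal {v : ℝ → Fin d → ℝ} (h : ∀ i, Integrable (fun x => v x i) rootMeasure)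
    (Q : DyadicInterval) :
    avg Q (fun x => realDiagonal (v x)) = realDiagonal fun i => avg Q fun x => v x i := by
  rw [DyadicInterval.avg_eq_smul, realDiagonal_eq_sum fun i => avg Q fun x => v x i]
  have h1 : (fun x => realDiagonal (v x))
      = fun x => ∑ i, v x i • realDiagonal (Pi.single i 1) := by
    ext1 x
    exact realDiagonal_eq_sum _
  rw [h1, integral_finsetSum _ fun i _ =>
    (DyadicInterval.integrableOn_toSet (h i) Q).smul_const _, Finset.smul_sum]
  refine Finset.sum_congr rfl fun i _ => ?_
  rw [integral_smul_const, smul_smul, DyadicInterval.avg_eq_smul, smul_eq_mul]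

theorem isMatrixWeight_realDiagonal {v : ℝ → Fin d → ℝ}
    (hpos : ∀ᵐ x ∂rootMeasure, ∀ i, 0 < v x i) (h : ∀ i, Integrable (fun x => v x i) rootMeasure)
    (h' : ∀ i, Integrable (fun x => (v x i)⁻¹) rootMeasure) :
    IsMatrixWeight fun x => realDiagonal (v x) where
  posDef := hpos.mono fun _ hx => posDef_realDiagonal hx
  integrable := integrable_realDiagonal h
  integrable_inv := (integrable_realDiagonal (v := fun x i => (v x i)⁻¹) h').congr
    (hpos.mono fun _ hx => (inv_realDiagonal fun i => (hx i).ne').symm)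

theorem avg_congr {F : Type*} [NormedAddCommGroup F] [NormedSpace ℝ F] {f g : ℝ → F}
    (h : ∀ᵐ x ∂rootMeasure, f x = g x) (Q : DyadicInterval) : avg Q f = avg Q g := by
  rw [DyadicInterval.avg_eq_smul, DyadicInterval.avg_eq_smul,
    integral_congr_ae (DyadicInterval.ae_toSet h Q)]

theorem avg_const (Q : DyadicInterval) (c : ℝ) : avg Q (fun _ => c) = c := by
  rw [DyadicInterval.avg_eq_smul, setIntegral_const, DyadicInterval.volume_real_toSet,
    inv_smul_smul₀ (DyadicInterval.length_pos Q).ne']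

theorem charA2_realDiagonal {v : ℝ → Fin d → ℝ} (hpos : ∀ᵐ x ∂rootMeasure, ∀ i, 0 < v x i)
    (h : ∀ i, Integrable (fun x => v x i) rootMeasure)
    (h' : ∀ i, Integrable (fun x => (v x i)⁻¹) rootMeasure) :
    charA2 (fun x => realDiagonal (v x)) = ⨆ Q : DyadicInterval, ‖realDiagonal fun i =>
      √(avg Q fun x => v x i) * √(avg Q fun x => (v x i)⁻¹)‖ₑ ^ 2 := by
  rw [charA2]
  congr 1
  ext1 Q
  have h1 : ∀ᵐ x ∂rootMeasure, (realDiagonal (v x))⁻¹ = realDiagonal fun i => (v x i)⁻¹ :=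
    hpos.mono fun _ hx => inv_realDiagonal fun i => (hx i).ne'
  rw [avg_congr h1, avg_realDiagonal h, avg_realDiagonal (v := fun x i => (v x i)⁻¹) h',
    sqrt_realDiagonal fun i => (DyadicInterval.avg_pos (h i) (hpos.mono fun x hx => hx i) Q).le,
    sqrt_realDiagonal fun i => (DyadicInterval.avg_pos (h' i)
      (hpos.mono fun x hx => inv_pos.2 (hx i)) Q).le, realDiagonal_mul]

/-- The vector `(t, 1, …, 1)`. -/
def firstEntry [NeZero d] (t : ℝ) : Fin d → ℝ := fun i => if i = 0 then t else 1

section Constant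

variable [NeZero d] {κ : ℝ≥0}

theorem firstEntry_pos {t : ℝ} (h : 0 < t) (i : Fin d) : 0 < firstEntry t i := by
  unfold firstEntry
  split_ifs
  exacts [h, one_pos]

theorem isMatrixWeight_const (hκ : 1 ≤ κ) :
    IsMatrixWeight fun _ => realDiagonal (firstEntry (d := d) κ) :=
  isMatrixWeight_realDiagonal
    (ae_of_all _ fun _ => firstEntry_pos (one_pos.trans_le (by exact_mod_cast hκ)))
    (fun _ => integrable_const _) fun _ => integrable_const _

theorem charA2_const (hκ : 1 ≤ κ) :
    charA2 (fun _ => realDiagonal (firstEntry (d := d) κ)) = 1 := by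
  have hpos := firstEntry_pos (d := d) (t := κ) (one_pos.trans_le (by exact_mod_cast hκ))
  rw [charA2_realDiagonal (v := fun _ => firstEntry κ) (ae_of_all _ fun _ => hpos)
    (fun _ => integrable_const _) fun _ => integrable_const _]
  have : Nonempty DyadicInterval := ⟨DyadicInterval.root⟩
  have h1 : ∀ Q : DyadicInterval, (fun i : Fin d => √(avg Q fun _ => firstEntry (κ : ℝ) i) *
      √(avg Q fun _ => (firstEntry (κ : ℝ) i)⁻¹)) = fun _ => 1 := by
    intro Q
    ext i
    rw [avg_const, avg_const, ← Real.sqrt_mul (hpos i).le, mul_inv_cancel₀ (hpos i).ne', Real.sqrt_one]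
  simp only [h1, realDiagonal_one]
  rw [iSup_const, enorm_one, one_pow]

/-- With `d ≥ 2` both `κ` and `1` occur as eigenvalues, so the norm is `κ` and the norm of the
inverse is `1`. -/
theorem condC2_const (hd : 2 ≤ d) (hκ : 1 ≤ κ) :
    condC2 (fun _ => realDiagonal (firstEntry (d := d) κ)) = κ := by
  have hκ' : (1 : ℝ) ≤ κ := by exact_mod_cast hκ
  have hpos := firstEntry_pos (d := d) (t := κ) (one_pos.trans_le hκ')
  have hne : rootMeasure ≠ 0 := IsProbabilityMeasure.ne_zero _
  have hj : (⟨1, by omega⟩ : Fin d) ≠ 0 := by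
    intro h
    simpa using congrArg Fin.val h
  rw [condC2, essSup_const _ hne, inv_realDiagonal fun i => (hpos i).ne']
  have h1 : ‖realDiagonal (firstEntry (d := d) κ)‖ = κ := by
    refine le_antisymm (norm_realDiagonal_le κ.coe_nonneg fun i => ?_) ?_
    · rw [abs_of_pos (hpos i), firstEntry]
      split_ifs
      exacts [le_rfl, hκ']
    · refine le_trans ?_ (abs_le_norm_realDiagonal _ 0)
      simp [firstEntry]
  have h2 : ‖realDiagonal fun i => (firstEntry (d := d) κ i)⁻¹‖ = 1 := by
    refine le_antisymm (norm_realDiagonal_le zero_le_one fun i => ?_) ?_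
    · rw [abs_of_pos (inv_pos.2 (hpos i)), firstEntry]
      split_ifs
      exacts [inv_le_one_of_one_le₀ hκ', by simp]
    · refine le_trans ?_ (abs_le_norm_realDiagonal _ ⟨1, by omega⟩)
      simp [firstEntry, hj]
  rw [← ofReal_norm, ← ofReal_norm, h1, h2]
  simp

end Constant

theorem exists_one_le_lt_rpow {q : ℝ} (hq : 0 < q) (C : ℝ≥0) :
    ∃ κ : ℝ≥0, 1 ≤ κ ∧ C < κ ^ q := by
  refine ⟨(C + 1) ^ q⁻¹, NNReal.one_le_rpow (by simp) (inv_pos.2 hq).le, ?_⟩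
  rw [← NNReal.rpow_mul, inv_mul_cancel₀ hq.ne', NNReal.rpow_one]
  exact lt_add_one C

/-! ### A single `A_2` weight with unbounded conditioning. -/

section SquareRoot

theorem ae_pos_rootMeasure : ∀ᵐ x ∂rootMeasure, (0 : ℝ) < x := by
  rw [rootMeasure, ← Measure.restrict_congr_set (Ioo_ae_eq_Ico (a := (0 : ℝ)) (b := 1))]
  exact (ae_restrict_mem measurableSet_Ioo).mono fun x hx => hx.1

theorem inv_sqrt_eq_rpow {x : ℝ} (hx : 0 ≤ x) : (√x)⁻¹ = x ^ (-(1 / 2) : ℝ) := by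
  rw [Real.sqrt_eq_rpow, Real.rpow_neg hx]

theorem integrable_sqrt : Integrable (fun x : ℝ => √x) rootMeasure :=
  (Real.continuous_sqrt.integrableOn_Icc (a := 0) (b := 1)).mono_set Set.Ico_subset_Icc_self

theorem integrable_inv_sqrt : Integrable (fun x : ℝ => (√x)⁻¹) rootMeasure := by
  have h1 : IntervalIntegrable (fun x : ℝ => x ^ (-(1 / 2) : ℝ)) volume 0 1 :=
    intervalIntegral.intervalIntegrable_rpow' (by norm_num)
  rw [intervalIntegrable_iff_integrableOn_Ico_of_le zero_le_one] at h1
  refine Integrable.congr (f := fun x : ℝ => x ^ (-(1 / 2) : ℝ)) h1 ?_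
  exact ae_pos_rootMeasure.mono fun x hx => (inv_sqrt_eq_rpow hx.le).symm

/-- The dyadic `A₂` condition for the square root. -/
theorem avg_sqrt_mul_avg_inv_sqrt_le (Q : DyadicInterval) :
    avg Q (fun x => √x) * avg Q (fun x => (√x)⁻¹) ≤ 2 := by
  set a : ℝ := ((Q.index : ℕ) : ℝ) / 2 ^ Q.level with ha
  set b : ℝ := (((Q.index : ℕ) : ℝ) + 1) / 2 ^ Q.level with hb
  have hl := DyadicInterval.length_pos Q
  have ha0 : 0 ≤ a := by positivity
  have hba : b - a = Q.length := by
    rw [hb, ha, DyadicInterval.length]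
    ring
  have hab : a ≤ b := by linarith
  have hQ : Q.toSet = Set.Ico a b := rfl
  -- The crude bound `√x ≤ √b` suffices: the other integral is exactly `2 (√b - √a)`, and `√b (√b -
  -- √a) ≤ b - a`.
  have h1 : ∫ x in Q.toSet, √x ≤ Q.length * √b := by
    have : ∫ x in Q.toSet, √b = Q.length * √b := by
      rw [setIntegral_const, DyadicInterval.volume_real_toSet, smul_eq_mul]
    rw [← this]
    refine setIntegral_mono_on (DyadicInterval.integrableOn_toSet integrable_sqrt Q)
      (integrable_const _) (DyadicInterval.measurableSet_toSet Q) fun x hx => ?_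
    rw [hQ] at hx
    exact Real.sqrt_le_sqrt hx.2.le
  have h2 : ∫ x in Q.toSet, (√x)⁻¹ = 2 * (√b - √a) := by
    have e1 : ∫ x in Q.toSet, (√x)⁻¹ = ∫ x in Q.toSet, x ^ (-(1 / 2) : ℝ) := by
      refine setIntegral_congr_fun (DyadicInterval.measurableSet_toSet Q) fun x hx => ?_
      rw [hQ] at hx
      exact inv_sqrt_eq_rpow (ha0.trans hx.1)
    rw [e1, hQ, integral_Ico_eq_integral_Ioc, ← intervalIntegral.integral_of_le hab,
      integral_rpow (Or.inl (by norm_num)), Real.sqrt_eq_rpow, Real.sqrt_eq_rpow]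
    norm_num
    ring
  have hsa := Real.sqrt_nonneg a
  have hsab : √a ≤ √b := Real.sqrt_le_sqrt hab
  have h3 : √b * (√b - √a) ≤ Q.length := by
    have e1 := Real.mul_self_sqrt ha0
    have e2 := Real.mul_self_sqrt (ha0.trans hab)
    nlinarith
  rw [DyadicInterval.avg_eq_smul, DyadicInterval.avg_eq_smul, smul_eq_mul, smul_eq_mul, h2]
  calc _ ≤ Q.length⁻¹ * (Q.length * √b) * (Q.length⁻¹ * (2 * (√b - √a))) := by
        gcongr
    _ = 2 * (Q.length⁻¹ * (√b * (√b - √a))) := by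
        field_simp
    _ ≤ 2 * (Q.length⁻¹ * Q.length) := by gcongr
    _ = 2 := by rw [inv_mul_cancel₀ hl.ne', mul_one]

variable [NeZero d]

theorem ae_firstEntry_sqrt_pos :
    ∀ᵐ x ∂rootMeasure, ∀ i, 0 < firstEntry (d := d) (√x) i :=
  ae_pos_rootMeasure.mono fun _ hx => firstEntry_pos (Real.sqrt_pos.2 hx)

theorem integrable_firstEntry_sqrt (i : Fin d) :
    Integrable (fun x => firstEntry (√x) i) rootMeasure := by
  unfold firstEntry
  split_ifs
  exacts [integrable_sqrt, integrable_const _]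

theorem integrable_firstEntry_sqrt_inv (i : Fin d) :
    Integrable (fun x => (firstEntry (√x) i)⁻¹) rootMeasure := by
  unfold firstEntry
  split_ifs
  exacts [integrable_inv_sqrt, integrable_const _]

theorem isMatrixWeight_sqrt : IsMatrixWeight fun x => realDiagonal (firstEntry (d := d) (√x)) :=
  isMatrixWeight_realDiagonal ae_firstEntry_sqrt_pos integrable_firstEntry_sqrt
    integrable_firstEntry_sqrt_inv

theorem charA2_sqrt_ne_top : charA2 (fun x => realDiagonal (firstEntry (d := d) (√x))) ≠ ∞ := by
  rw [charA2_realDiagonal ae_firstEntry_sqrt_pos integrable_firstEntry_sqrt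
    integrable_firstEntry_sqrt_inv]
  refine ne_top_of_le_ne_top (ENNReal.ofReal_ne_top (r := √2 ^ 2)) (iSup_le fun Q => ?_)
  rw [ENNReal.ofReal_pow (Real.sqrt_nonneg 2), ← ofReal_norm]
  gcongr
  refine norm_realDiagonal_le (Real.sqrt_nonneg 2) fun i => ?_
  have h0 : 0 ≤ avg Q fun x => firstEntry (√x) i := (DyadicInterval.avg_pos
    (integrable_firstEntry_sqrt i) (ae_firstEntry_sqrt_pos.mono fun x hx => hx i) Q).le
  rw [abs_of_nonneg (by positivity), ← Real.sqrt_mul h0]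
  refine Real.sqrt_le_sqrt ?_
  by_cases hi : i = 0
  · simpa only [firstEntry, hi, if_true] using avg_sqrt_mul_avg_inv_sqrt_le Q
  · simp only [firstEntry, hi, if_false, avg_const]
    norm_num

theorem not_bilinearEmbedding_sqrt (hd : 2 ≤ d) (C : ℝ≥0) :
    ¬ BilinearEmbedding (fun x => realDiagonal (firstEntry (d := d) (√x))) 1 (C : ℝ≥0∞) := by
  intro h
  have h1 := isMatrixWeight_sqrt.ae_le_of_bilinearEmbedding h
  have hj : (⟨1, by omega⟩ : Fin d) ≠ 0 := by
    intro h
    simpa using congrArg Fin.val h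
  have h2 : ∀ᵐ x ∂rootMeasure, (√x)⁻¹ ≤ (C : ℝ) ^ 2 := by
    filter_upwards [h1, ae_firstEntry_sqrt_pos (d := d), ae_pos_rootMeasure] with x hx hpos hx0
    have hs := Real.sqrt_pos.2 hx0
    rw [inv_realDiagonal fun i => (hpos i).ne'] at hx
    have e1 : 1 ≤ ‖realDiagonal (firstEntry (d := d) (√x))‖ := by
      refine le_trans ?_ (abs_le_norm_realDiagonal _ ⟨1, by omega⟩)
      simp [firstEntry, hj]
    have e2 : (√x)⁻¹ ≤ ‖realDiagonal fun i => (firstEntry (d := d) (√x) i)⁻¹‖ := by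
      refine le_trans ?_ (abs_le_norm_realDiagonal _ 0)
      simp only [firstEntry, if_true]
      exact le_abs_self _
    calc (√x)⁻¹ = 1 * (√x)⁻¹ := (one_mul _).symm
      _ ≤ _ := by gcongr
      _ ≤ _ := hx
  -- Chosen so that `x < ε` forces `(√x)⁻¹ ≥ C ^ 2 + 1`; the interval `(0, ε)` would then be null.
  set ε : ℝ := (((C : ℝ) ^ 2 + 1) ^ 2)⁻¹ with hε
  have hε0 : 0 < ε := by positivity
  have hε1 : ε ≤ 1 := inv_le_one_of_one_le₀ (one_le_pow₀ (by nlinarith [sq_nonneg (C : ℝ)]))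
  have h3 : rootMeasure (Set.Ioo 0 ε) = 0 := by
    refine measure_mono_null (fun x hx => ?_) h2
    intro hle
    have e1 : √x ≤ ((C : ℝ) ^ 2 + 1)⁻¹ := by
      rw [Real.sqrt_le_left (by positivity), inv_pow]
      exact hx.2.le
    have e2 := (le_inv_comm₀ (Real.sqrt_pos.2 hx.1) (by positivity)).1 e1
    have e3 : (√x)⁻¹ ≤ (C : ℝ) ^ 2 := hle
    linarith
  rw [rootMeasure, Measure.restrict_apply measurableSet_Ioo, Set.inter_eq_left.2
    (fun x hx => Set.mem_Ico.2 ⟨hx.1.le, hx.2.trans_le hε1⟩), Real.volume_Ioo, sub_zero,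
    ENNReal.ofReal_eq_zero] at h3
  linarith

end SquareRoot

end MatrixBET

end

/-! ### Assembly of the four assertions. -/

theorem theorem4 :
    -- the embedding, with a constant that depends on the dimension only
    (∀ d : ℕ, ∃ C : ℝ≥0, ∀ W : ℝ → Matrix (Fin d) (Fin d) ℂ, MatrixBET.IsMatrixWeight W →
      ∀ M : ℝ≥0, MatrixBET.BilinearEmbedding W M
        ((C : ℝ≥0∞) * (M : ℝ≥0∞) * MatrixBET.condC2 W ^ (1 / 2 : ℝ))) ∧
    -- necessity of the condition, for every single weight
    (∀ d : ℕ, ∀ W : ℝ → Matrix (Fin d) (Fin d) ℂ, MatrixBET.IsMatrixWeight W →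
      ∀ C : ℝ≥0, MatrixBET.BilinearEmbedding W 1 (C : ℝ≥0∞) →
        MatrixBET.condC2 W ^ (1 / 2 : ℝ) ≤ (C : ℝ≥0∞)) ∧
    -- optimality of the power
    (∀ d : ℕ, 2 ≤ d → ∀ p : ℝ, p < 1 / 2 →
      ¬ ∃ C : ℝ≥0, ∀ W : ℝ → Matrix (Fin d) (Fin d) ℂ, MatrixBET.IsMatrixWeight W →
        MatrixBET.condC2 W ≠ ∞ →
          MatrixBET.BilinearEmbedding W 1 ((C : ℝ≥0∞) * MatrixBET.condC2 W ^ p)) ∧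
    -- insufficiency of the matrix `A_2` condition: no uniform constant even if it equals one
    (∀ d : ℕ, 2 ≤ d →
      ¬ ∃ C : ℝ≥0, ∀ W : ℝ → Matrix (Fin d) (Fin d) ℂ, MatrixBET.IsMatrixWeight W →
        MatrixBET.charA2 W = 1 → MatrixBET.BilinearEmbedding W 1 (C : ℝ≥0∞)) ∧
    -- and a single `A_2` weight without any finite constant
    (∀ d : ℕ, 2 ≤ d →
      ∃ W : ℝ → Matrix (Fin d) (Fin d) ℂ, MatrixBET.IsMatrixWeight W ∧
        MatrixBET.charA2 W ≠ ∞ ∧ ∀ C : ℝ≥0, ¬ MatrixBET.BilinearEmbedding W 1 (C : ℝ≥0∞)) := by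
  refine ⟨fun d => ⟨16 * (d + 1), fun W hW M => ?_⟩,
    fun d W hW C h => hW.condC2_le_of_bilinearEmbedding h, fun d hd p hp => ?_, fun d hd => ?_,
    fun d hd => ?_⟩
  · exact MatrixBET.bilinearEmbedding_of_isMatrixWeight hW M
  · rintro ⟨C, hC⟩
    have : NeZero d := ⟨by omega⟩
    -- Necessity for the constant weight would give `κ ^ (1/2) ≤ C κ ^ p`, so `κ` is taken with `κ ^
    -- (1/2 - p) > C`.
    obtain ⟨κ, hκ, hlt⟩ := MatrixBET.exists_one_le_lt_rpow (sub_pos.2 hp) C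
    have hκ0 : κ ≠ 0 := (one_pos.trans_le hκ).ne'
    have h1 := hC _ (MatrixBET.isMatrixWeight_const (d := d) hκ)
      (by rw [MatrixBET.condC2_const hd hκ]; exact ENNReal.coe_ne_top)
    rw [MatrixBET.condC2_const hd hκ, ← ENNReal.coe_rpow_of_ne_zero hκ0, ← ENNReal.coe_mul] at h1
    have h2 := (MatrixBET.isMatrixWeight_const (d := d) hκ).condC2_le_of_bilinearEmbedding h1
    rw [MatrixBET.condC2_const hd hκ, ← ENNReal.coe_rpow_of_ne_zero hκ0, ENNReal.coe_le_coe,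
      ← div_le_iff₀ (NNReal.rpow_pos (pos_of_ne_zero hκ0)), ← NNReal.rpow_sub hκ0] at h2
    exact absurd h2 hlt.not_ge
  · rintro ⟨C, hC⟩
    have : NeZero d := ⟨by omega⟩
    obtain ⟨κ, hκ, hlt⟩ := MatrixBET.exists_one_le_lt_rpow (q := 1 / 2) (by norm_num) C
    have hκ0 : κ ≠ 0 := (one_pos.trans_le hκ).ne'
    have h1 := hC _ (MatrixBET.isMatrixWeight_const (d := d) hκ) (MatrixBET.charA2_const hκ)
    have h2 := (MatrixBET.isMatrixWeight_const (d := d) hκ).condC2_le_of_bilinearEmbedding h1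
    rw [MatrixBET.condC2_const hd hκ, ← ENNReal.coe_rpow_of_ne_zero hκ0, ENNReal.coe_le_coe] at h2
    exact absurd h2 hlt.not_ge
  · have : NeZero d := ⟨by omega⟩
    exact ⟨_, MatrixBET.isMatrixWeight_sqrt, MatrixBET.charA2_sqrt_ne_top,
      MatrixBET.not_bilinearEmbedding_sqrt hd⟩
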